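/- **Setting.** Let $\mathcal F$ be the family of compact convex sets $S\subset\mathbb R^2$ with nonempty interior whose boundary is a $C^3$ regular closed curve with everywhere positive curvature; for a point $M$ of the plane let $\mathcal F_M=\{S\in\mathcal F: M\in\partial S\}$, and let $\theta_M(S)$ be the tangent direction of $\partial S$ at $M$ ($\partial S$ being run counterclockwise). The Gauss digitization of $S$ with step $h>0$ is $G_h(S)=S\cap(h\mathbb Z\times h\mathbb Z)$. A convex digital polygon (CDP) is a nonempty finite 4-connected set $\Gamma\subset h\mathbb Z\times h\mathbb Z$ with $\Gamma=G_h(\operatorname{conv}\Gamma)$; its vertices are the extreme points of $\operatorname{conv}\Gamma$, and its edges join two consecutive vertices (in counterclockwise order). An edge with vector $h(a,b)$, $a,b\in\mathbb Z$, has the digital parameters $\delta=\gcd(a,b)$, $p=\min(|a|,|b|)/\delta$, $q=\max(|a|,|b|)/\delta$ (so in the first octant the slope is the irreducible fraction $p/q$, and its pattern is repeated $\delta$ times). **Estimator.** If $M\in\partial S$ is on the upper part of the boundary with tangent in the first octant, an edge lies below $M$ if it contains the first point at which the ray going vertically down from $M$ meets $\operatorname{conv}G_h(S)$, and the estimate $\hat\theta_{M}(G_h(S))$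 of $\theta_M(S)$ is the arctangent of the slope of such an edge. In the other octants one proceeds in the same way after the symmetry of the grid that maps the octant to the first one: "down" is the coordinate direction closest to the inward normal at $M$, and the estimate is the direction of the edge. (If the ray hits a vertex, or if $\theta_M(S)$ belongs to two octants, every choice is allowed.) The error is the angle between the two directions, which equals the absolute difference of the arctangents of the slopes in the first octant. **Proposition.** Let $M$ be a point of the plane. 1. The estimator is multigrid convergent toward $\theta_M$ for $\mathcal F_M$ and Gauss digitization: there is a function $\tau:(0,\infty)\to(0,\infty)$ with $\tau(h)\to0$ as $h\to0$ such that for every $S\in\mathcal F_M$ there is $h_S>0$ such that for all $0<h<h_S$ the set $G_h(S)$ is a CDP, some edge of it lies below $M$, and $|\hat\theta_M(G_h(S))-\theta_M(S)|\le\tau(h)$ for every edge lying below $M$. 2. Let $S\in\mathcal F_M$, and assume the following law (the Claim) for $S$: as $h\to0$, the means over all edges of $G_h(S)$ of the parameters $p$ and of the parameters $q$ are both $\Theta(h^{-1/3})$, and the mean of $\delta$ is $O(1)$. Then the speed of convergence is on average $O(h^{2/3})$: if for each edge $e$ of $G_h(S)$ we denote by $E_h(e)$ the supremum of the estimation errors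 made with $e$ at the points $M'\in\partial S$ below which $e$ lies ($E_h(e)=0$ if there are none), then the mean of $E_h(e)$ over all edges $e$ of $G_h(S)$ is $O(h^{2/3})$ as $h\to0$ (the constant may depend on $S$). -/

import Mathlib

open Real Set Filter Topology Asymptotics

noncomputable section

/-- The Euclidean plane. -/
abbrev Plane : Type := EuclideanSpace ℝ (Fin 2)

/-- The determinant of two plane vectors. -/
def det2 (a b : Plane) : ℝ := a 0 * b 1 - a 1 * b 0

/-! ### Shapes -/

/-- `γ` is a `T`-periodic, simple, regular `C³` parametrization of the boundary of `S`, run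
counterclockwise, and its curvature `det2 γ' γ'' / ‖γ'‖ ^ 3` is positive everywhere
(in particular `γ'` never vanishes). -/
structure IsBoundaryParam (S : Set Plane) (γ : ℝ → Plane) (T : ℝ) : Prop where
  period_pos : 0 < T
  contDiff : ContDiff ℝ 3 γ
  periodic : Function.Periodic γ T
  injOn : InjOn γ (Ico 0 T)
  range_eq : range γ = frontier S
  curvature_pos : ∀ t, 0 < det2 (deriv γ t) (deriv (deriv γ) t)

/-- The plane convex bodies with `C³` boundary and positive curvature. -/
def ConvexC3Shapes : Set (Set Plane) :=
  {S | Convex ℝ S ∧ IsCompact S ∧ (interior S).Nonempty ∧ ∃ γ T, IsBoundaryParam S γ T}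

/-- The shapes of the family whose boundary passes through `M`. -/
def ConvexC3ShapesThrough (M : Plane) : Set (Set Plane) :=
  {S | S ∈ ConvexC3Shapes ∧ M ∈ frontier S}

/-- `v` is a (counterclockwise) tangent vector of the boundary of `S` at `M`. It is nonzero and
unique up to a positive factor; its direction is the tangent direction `θ_M`. -/
def IsTangent (S : Set Plane) (M v : Plane) : Prop :=
  ∃ γ T t, IsBoundaryParam S γ T ∧ γ t = M ∧ deriv γ t = v

/-! ### Gauss digitization and convex digital polygons -/

/-- The point of the grid `hℤ × hℤ` with integer coordinates `k`. -/
def gridPt (h : ℝ) (k : ℤ × ℤ) : Plane := !₂[h * k.1, h * k.2]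

/-- The Gauss digitization of `S` with grid step `h`. -/
def gaussDig (h : ℝ) (S : Set Plane) : Set Plane := S ∩ range (gridPt h)

/-- Two points of the grid `hℤ × hℤ` are 4-adjacent. -/
def FourAdj (h : ℝ) (P Q : Plane) : Prop :=
  ∃ k l : ℤ × ℤ, P = gridPt h k ∧ Q = gridPt h l ∧ |k.1 - l.1| + |k.2 - l.2| = 1

/-- Convex digital polygons of `hℤ × hℤ`: finite digital sets that form a single 4-connected
component and are the Gauss digitization of their convex hull. -/
structure IsCDP (h : ℝ) (Γ : Set Plane) : Prop where
  finite : Γ.Finite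
  nonempty : Γ.Nonempty
  connected : ∀ P ∈ Γ, ∀ Q ∈ Γ,
    Relation.ReflTransGen (fun A B => A ∈ Γ ∧ B ∈ Γ ∧ FourAdj h A B) P Q
  eq_dig : Γ = gaussDig h (convexHull ℝ Γ)

/-- The edges of the digital polygon `Γ`, as pairs of consecutive vertices in counterclockwise
order (the vertices are given by their integer coordinates): the vertices are the extreme points
of the convex hull, and `Γ` lies on the left of the line through two consecutive ones. -/
def edges (h : ℝ) (Γ : Set Plane) : Set ((ℤ × ℤ) × (ℤ × ℤ)) :=
  {e | e.1 ≠ e.2 ∧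
    gridPt h e.1 ∈ (convexHull ℝ Γ).extremePoints ℝ ∧
    gridPt h e.2 ∈ (convexHull ℝ Γ).extremePoints ℝ ∧
    ∀ P ∈ Γ, 0 ≤ det2 (gridPt h e.2 - gridPt h e.1) (P - gridPt h e.1)}

/-- The vector of an edge. -/
def edgeVec (h : ℝ) (e : (ℤ × ℤ) × (ℤ × ℤ)) : Plane := gridPt h e.2 - gridPt h e.1

/-! ### Digital parameters of an edge

For an edge with slope in the first octant, the slope is the irreducible fraction `p / q` with
`0 ≤ p ≤ q` and `δ` is the number of repetitions of the pattern of that slope; in the other octants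
these are the parameters of the image of the edge under the symmetry of the grid that maps its
octant to the first one. -/

def edgeDelta (e : (ℤ × ℤ) × (ℤ × ℤ)) : ℕ :=
  Int.gcd (e.2.1 - e.1.1) (e.2.2 - e.1.2)

def edgeP (e : (ℤ × ℤ) × (ℤ × ℤ)) : ℕ :=
  min (e.2.1 - e.1.1).natAbs (e.2.2 - e.1.2).natAbs / edgeDelta e

def edgeQ (e : (ℤ × ℤ) × (ℤ × ℤ)) : ℕ :=
  max (e.2.1 - e.1.1).natAbs (e.2.2 - e.1.2).natAbs / edgeDelta e

/-- The mean of `f` over the edges of the Gauss digitization of `S` with grid step `h`. -/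
def edgeMean (h : ℝ) (S : Set Plane) (f : (ℤ × ℤ) × (ℤ × ℤ) → ℝ) : ℝ :=
  (∑ᶠ e ∈ edges h (gaussDig h S), f e) / (edges h (gaussDig h S)).ncard

/-- The asymptotic law for the shape `S`: on average over the edges of the digitization, `p` and
`q` grow as `Θ(1 / h ^ (1/3))` and `δ` stays bounded, when `h` tends to `0`. -/
structure AsymptoticEdgeLaw (S : Set Plane) : Prop where
  p_theta : (fun h : ℝ => edgeMean h S (fun e => (edgeP e : ℝ)))
    =Θ[𝓝[>] 0] (fun h : ℝ => 1 / h ^ (1 / 3 : ℝ))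
  q_theta : (fun h : ℝ => edgeMean h S (fun e => (edgeQ e : ℝ)))
    =Θ[𝓝[>] 0] (fun h : ℝ => 1 / h ^ (1 / 3 : ℝ))
  delta_bounded : (fun h : ℝ => edgeMean h S (fun e => (edgeDelta e : ℝ)))
    =O[𝓝[>] 0] (fun _ : ℝ => (1 : ℝ))

/-! ### The tangent estimator -/

/-- `d` is the coordinate direction that plays the role of "down" at a boundary point with
counterclockwise tangent vector `v`: among the four coordinate directions, one that makes the
least angle with the inward normal `(-v 1, v 0)`. It is `(0, -1)` when the point is on the upper
part of the boundary and the slope of the tangent is in `[-1, 1]`, in particular in the first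
octant. Only for tangents of slope `1` or `-1`, which belong to two octants, are there two such
directions. -/
def IsDown (v d : Plane) : Prop :=
  d ∈ ({!₂[1, 0], !₂[-1, 0], !₂[0, 1], !₂[0, -1]} : Set Plane) ∧ det2 v d = max |v 0| |v 1|

/-- The edge `e` of the digital polygon `Γ` lies below `M`, for the downward direction `d`: the ray
going down from `M` meets the convex hull of `Γ`, and the first point it meets is on `e`. -/
def LiesBelow (h : ℝ) (Γ : Set Plane) (e : (ℤ × ℤ) × (ℤ × ℤ)) (M d : Plane) : Prop :=
  ∃ s : ℝ, 0 ≤ s ∧ M + s • d ∈ segment ℝ (gridPt h e.1) (gridPt h e.2) ∧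
    ∀ r : ℝ, 0 ≤ r → r < s → M + r • d ∉ convexHull ℝ Γ

/-- The error of the estimation of the direction of the tangent vector `v` by the direction of the
edge `e`: the angle between the two directions. When both are on the same side of the vertical
it is the absolute difference of the arctangents of the slopes, see `angle_eq_abs_arctan_sub`. -/
def directionError (h : ℝ) (e : (ℤ × ℤ) × (ℤ × ℤ)) (v : Plane) : ℝ :=
  InnerProductGeometry.angle (edgeVec h e) v

theorem angle_eq_abs_arctan_sub (u v : Plane) (huv : 0 < u 0 * v 0) :
    InnerProductGeometry.angle u v = |arctan (u 1 / u 0) - arctan (v 1 / v 0)| := by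
  have hu : u 0 ≠ 0 := left_ne_zero_of_mul huv.ne'
  have hv : v 0 ≠ 0 := right_ne_zero_of_mul huv.ne'
  have key : ∀ w : Plane, w 0 ≠ 0 → ‖w‖ = |w 0| * √(1 + (w 1 / w 0) ^ 2) := by
    intro w hw
    rw [EuclideanSpace.norm_eq, Fin.sum_univ_two, ← Real.sqrt_sq_eq_abs,
      ← Real.sqrt_mul (sq_nonneg _)]
    congr 1
    simp only [Real.norm_eq_abs, sq_abs]
    field_simp
  have hcos : Real.cos (arctan (u 1 / u 0) - arctan (v 1 / v 0))
      = inner ℝ u v / (‖u‖ * ‖v‖) := by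
    rw [Real.cos_sub, Real.cos_arctan, Real.cos_arctan, Real.sin_arctan, Real.sin_arctan,
      key u hu, key v hv, PiLp.inner_apply, Fin.sum_univ_two]
    have h1 : 0 < √(1 + (u 1 / u 0) ^ 2) := Real.sqrt_pos.2 (by positivity)
    have h2 : 0 < √(1 + (v 1 / v 0) ^ 2) := Real.sqrt_pos.2 (by positivity)
    have h3 : |u 0| * |v 0| = u 0 * v 0 := by rw [← abs_mul, abs_of_pos huv]
    have h4 : |u 0| * √(1 + (u 1 / u 0) ^ 2) * (|v 0| * √(1 + (v 1 / v 0) ^ 2))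
        = u 0 * v 0 * (√(1 + (u 1 / u 0) ^ 2) * √(1 + (v 1 / v 0) ^ 2)) := by
      rw [← h3]; ring
    rw [h4]
    generalize √(1 + (u 1 / u 0) ^ 2) = a at *
    generalize √(1 + (v 1 / v 0) ^ 2) = b at *
    simp only [RCLike.inner_apply, conj_trivial]
    field_simp
  rw [InnerProductGeometry.angle, ← hcos, ← Real.cos_abs]
  apply Real.arccos_cos (abs_nonneg _)
  have b1 := Real.arctan_lt_pi_div_two (u 1 / u 0)
  have b2 := Real.neg_pi_div_two_lt_arctan (u 1 / u 0)
  have b3 := Real.arctan_lt_pi_div_two (v 1 / v 0)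
  have b4 := Real.neg_pi_div_two_lt_arctan (v 1 / v 0)
  rw [abs_le]
  constructor <;> linarith

/-- The largest error made with the edge `e`, over the boundary points of `S` that it lies
below (`0` if there are none). -/
def worstError (h : ℝ) (S : Set Plane) (e : (ℤ × ℤ) × (ℤ × ℤ)) : ℝ :=
  sSup {α | ∃ M v d, IsTangent S M v ∧ IsDown v d ∧ LiesBelow h (gaussDig h S) e M d ∧
    α = directionError h e v}

end

/-!
The geometry of the shape enters only through two tangent discs. The boundary `γ` satisfies
`γ (t + u) - γ t = u γ' t + u² G (t, u)` with `G` continuous (`taylor_two`), and its tangent line at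
`γ t` touches the shape only there (`IsBoundaryParam.inner_neg`). By compactness, the squared length
of a chord is therefore comparable to the distance of its end to the tangent at its origin, which
says that at every boundary point a disc of radius `r`, tangent to the boundary, lies inside the
shape, and that the shape lies inside such a disc of radius `R` (`HasRollingDiscs`). The inner discs
make the outward unit normal `1 / r`-Lipschitz along the boundary; the outer discs make a chord
short when its middle is close to the complement (`HasRollingDiscs.chord_sq_le`).

The error made with an edge `E` is `O(‖E‖)` (`HasRollingDiscs.directionError_le`). The vertices are
extreme, so the next grid points on the line of the edge are outside the shape, and the edge
extends to a chord of the boundary of length at most `3 ‖E‖`. The direction of `E` lies between the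
tangent directions at the two ends of this chord, and these differ by at most `3 ‖E‖ / r`. A point
`M` below which the edge lies is within `4 h` of the edge, since the convex hull of the digitization
contains the points of depth `2 h`; as `h ≤ ‖E‖`, its tangent direction is within `O(‖E‖)` too.

All points of an edge are within `3 h` of the complement of the shape, so that `‖E‖² ≤ 24 R h`. The
error is thus `O(√h)`, and `h ^ (1 / 4)` is a rate that serves all shapes. That edges exist below
every point is the fact that the edges cover the boundary of the hull
(`exists_edge_of_notMem_interior`), and digitizations are 4-connected because the shape is a union
of discs of radius `r` whose centers form a convex set.

For the mean error, `‖E‖ ≤ 2 h δ q`. If `δ ≥ 2`, the first grid line parallel to the edge on the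
outer side has a grid point above the middle of the edge. It is outside the shape and at distance at
most `h / q` from the edge, whence `δ² q³ h ≤ 11 R` (`HasRollingDiscs.edgeDelta_sq_mul_le`).
Consequently `δ q ≤ C q + h ^ (-1 / 3) δ`, and the assumed law bounds the means of both terms by
`O(h ^ (-1 / 3))`. The mean error is `O(h * h ^ (-1 / 3))`.
-/

noncomputable section

/-! ### Plane vectors and normals of convex sets -/

theorem plane_inner (a b : Plane) : inner ℝ a b = a 0 * b 0 + a 1 * b 1 := by
  simp [PiLp.inner_apply, Fin.sum_univ_two]; ring

theorem plane_norm_sq (a : Plane) : ‖a‖ ^ 2 = a 0 ^ 2 + a 1 ^ 2 := by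
  rw [← real_inner_self_eq_norm_sq, plane_inner]; ring

theorem plane_ext {a b : Plane} (h0 : a 0 = b 0) (h1 : a 1 = b 1) : a = b := by
  ext i; fin_cases i <;> assumption

theorem inner_sq_add_det2_sq (a b : Plane) :
    inner ℝ a b ^ 2 + det2 a b ^ 2 = ‖a‖ ^ 2 * ‖b‖ ^ 2 := by
  rw [plane_inner, plane_norm_sq, plane_norm_sq, det2]; ring

/-- `n` is an outward unit normal of `S` at `M`: the half-plane through `M` orthogonal to `n`
supports `S`. -/
def IsNormal (S : Set Plane) (M n : Plane) : Prop :=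
  ‖n‖ = 1 ∧ ∀ Y ∈ S, inner ℝ (Y - M) n ≤ 0

theorem IsPreconnected.exists_mem_frontier {X : Type*} [TopologicalSpace X] {A S : Set X}
    (hA : IsPreconnected A) {x y : X} (hx : x ∈ A) (hxS : x ∈ S) (hy : y ∈ A) (hyS : y ∉ S) :
    ∃ z ∈ A, z ∈ frontier S := by
  by_contra! hcon
  have hsub : A ⊆ interior S ∪ (closure S)ᶜ := by
    intro z hz
    by_cases h : z ∈ closure S
    · left
      by_contra h'
      exact hcon z hz ⟨h, h'⟩
    · right; exact h
  have hxi : x ∈ interior S := by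
    rcases hsub hx with h | h
    · exact h
    · exact absurd (subset_closure hxS) h
  have := hA.subset_left_of_subset_union isOpen_interior isClosed_closure.isOpen_compl
    (disjoint_compl_right.mono_left (interior_subset.trans subset_closure)) hsub ⟨x, hx, hxi⟩
  exact hyS (interior_subset (this hy))

theorem exists_mem_segment_frontier {S : Set Plane} {P Q : Plane} (hP : P ∈ S) (hQ : Q ∉ S) :
    ∃ A ∈ segment ℝ P Q, A ∈ frontier S :=
  (convex_segment P Q).isPreconnected.exists_mem_frontier (left_mem_segment ℝ P Q) hP
    (right_mem_segment ℝ P Q) hQ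

theorem exists_isNormal {S : Set Plane} (hS : Convex ℝ S) (hi : (interior S).Nonempty)
    {M : Plane} (hM : M ∉ interior S) : ∃ n, IsNormal S M n := by
  obtain ⟨f, hf⟩ := geometric_hahn_banach_open_point hS.interior isOpen_interior hM
  set w : Plane := (InnerProductSpace.toDual ℝ Plane).symm f with hw
  have hfw : ∀ x, inner ℝ x w = f x := fun x => by
    rw [real_inner_comm, hw, InnerProductSpace.toDual_symm_apply]
  obtain ⟨c, hc⟩ := hi
  have hw0 : w ≠ 0 := by
    intro h0
    have := hf c hc
    rw [← hfw, ← hfw, h0] at this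
    simp at this
  have hclos : ∀ Y ∈ S, f Y ≤ f M := by
    intro Y hY
    have h1 : Y ∈ closure (interior S) := by
      rw [hS.closure_interior_eq_closure_of_nonempty_interior ⟨c, hc⟩]
      exact subset_closure hY
    exact closure_minimal (fun a ha => (hf a ha).le)
      (isClosed_le f.continuous continuous_const) h1
  refine ⟨‖w‖⁻¹ • w, ?_, fun Y hY => ?_⟩
  · rw [norm_smul, norm_inv, norm_norm, inv_mul_cancel₀ (norm_ne_zero_iff.2 hw0)]
  · rw [inner_smul_right, inner_sub_left, hfw, hfw]
    exact mul_nonpos_of_nonneg_of_nonpos (by positivity) (by linarith [hclos Y hY])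

theorem IsNormal.notMem_interior {S : Set Plane} {M n : Plane} (hn : IsNormal S M n)
    {Y : Plane} (hY : inner ℝ (Y - M) n = 0) : Y ∉ interior S := by
  intro hi
  obtain ⟨ε, hε, hball⟩ := Metric.isOpen_iff.1 isOpen_interior Y hi
  have h1 : Y + (ε / 2) • n ∈ S := by
    apply interior_subset
    apply hball
    rw [Metric.mem_ball, dist_eq_norm, add_sub_cancel_left, norm_smul, hn.1, Real.norm_eq_abs,
      abs_of_pos (by linarith)]
    linarith
  have h2 := hn.2 _ h1
  rw [show Y + (ε / 2) • n - M = (Y - M) + (ε / 2) • n by abel, inner_add_left, hY,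
    inner_smul_left, real_inner_self_eq_norm_sq, hn.1] at h2
  simp at h2
  linarith

theorem IsNormal.inner_neg {S : Set Plane} {M n : Plane} (hn : IsNormal S M n)
    {c : Plane} (hc : c ∈ interior S) : inner ℝ (c - M) n < 0 :=
  lt_of_le_of_ne (hn.2 c (interior_subset hc)) fun h => hn.notMem_interior h hc

/-- A ball of `S` stays at distance its radius from every supporting line. -/
theorem IsNormal.inner_le_of_closedBall {S : Set Plane} {M n : Plane} (hn : IsNormal S M n)
    {c : Plane} {r : ℝ} (hr : 0 ≤ r) (hc : Metric.closedBall c r ⊆ S) :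
    inner ℝ (c - M) n ≤ -r := by
  have h1 : c + r • n ∈ S := by
    apply hc
    rw [Metric.mem_closedBall, dist_eq_norm, add_sub_cancel_left, norm_smul, hn.1,
      Real.norm_eq_abs, abs_of_nonneg hr, mul_one]
  have h2 := hn.2 _ h1
  rw [show c + r • n - M = (c - M) + r • n by abel, inner_add_left,
    inner_smul_left, real_inner_self_eq_norm_sq, hn.1] at h2
  simp at h2
  linarith

/-! ### Curvature bounds of the boundary -/

/-- The integral remainder of the second order Taylor formula, divided by `u ^ 2`. -/
def taylorRem (γ : ℝ → Plane) (t u : ℝ) : Plane :=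
  ∫ x in (0 : ℝ)..1, (1 - x) • deriv (deriv γ) (t + x * u)

variable {γ : ℝ → Plane}

theorem contDiff_deriv_deriv (h : ContDiff ℝ 3 γ) : Continuous (deriv (deriv γ)) := by
  have h1 : ContDiff ℝ 2 (deriv γ) := ((contDiff_succ_iff_deriv (n := 2)).1 h).2.2
  have h2 : ContDiff ℝ 1 (deriv (deriv γ)) := ((contDiff_succ_iff_deriv (n := 1)).1 h1).2.2
  exact h2.continuous

theorem hasDerivAt_of_contDiff (h : ContDiff ℝ 3 γ) (t : ℝ) : HasDerivAt γ (deriv γ t) t :=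
  (h.differentiable (by norm_num) t).hasDerivAt

theorem hasDerivAt_deriv_of_contDiff (h : ContDiff ℝ 3 γ) (t : ℝ) :
    HasDerivAt (deriv γ) (deriv (deriv γ) t) t := by
  have h1 : ContDiff ℝ 2 (deriv γ) := ((contDiff_succ_iff_deriv (n := 2)).1 h).2.2
  exact (h1.differentiable (by norm_num) t).hasDerivAt

theorem continuous_deriv_of_contDiff (h : ContDiff ℝ 3 γ) : Continuous (deriv γ) :=
  continuous_iff_continuousAt.2 fun t => (hasDerivAt_deriv_of_contDiff h t).continuousAt

theorem taylor_two (h : ContDiff ℝ 3 γ) (t u : ℝ) :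
    γ (t + u) - γ t = u • deriv γ t + u ^ 2 • taylorRem γ t u := by
  have hd : ∀ x ∈ uIcc (0 : ℝ) 1, HasDerivAt
      (fun x : ℝ => (u * (1 - x)) • deriv γ (t + x * u) + γ (t + x * u))
      (u ^ 2 • ((1 - x) • deriv (deriv γ) (t + x * u))) x := by
    intro x _
    have hin : HasDerivAt (fun x : ℝ => t + x * u) u x := by
      simpa using ((hasDerivAt_id x).mul_const u).const_add t
    have h1 := (hasDerivAt_of_contDiff h (t + x * u)).scomp x hin
    have h2 := (hasDerivAt_deriv_of_contDiff h (t + x * u)).scomp x hin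
    have h3 : HasDerivAt (fun x : ℝ => u * (1 - x)) (-u) x := by
      simpa using ((hasDerivAt_id x).const_sub 1).const_mul u
    refine ((h3.smul h2).add h1).congr_deriv ?_
    simp only [Function.comp_def, smul_smul]
    module
  have hc := contDiff_deriv_deriv h
  have := intervalIntegral.integral_eq_sub_of_hasDerivAt hd
    (Continuous.intervalIntegrable (by fun_prop) _ _)
  rw [intervalIntegral.integral_smul] at this
  rw [taylorRem, this]
  simp
  abel

theorem continuous_taylorRem (h : ContDiff ℝ 3 γ) :
    Continuous fun p : ℝ × ℝ => taylorRem γ p.1 p.2 := by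
  have hc := contDiff_deriv_deriv h
  unfold taylorRem
  apply intervalIntegral.continuous_parametric_intervalIntegral_of_continuous'
  unfold Function.uncurry
  fun_prop

theorem taylorRem_zero (t : ℝ) : taylorRem γ t 0 = (1 / 2 : ℝ) • deriv (deriv γ) t := by
  unfold taylorRem
  simp only [mul_zero, add_zero]
  rw [intervalIntegral.integral_smul_const]
  congr 1
  rw [intervalIntegral.integral_sub (by simp) (by simp)]
  norm_num

/-- The right unit normal of a plane vector, which points outwards along a boundary that is run
counterclockwise. -/
def rightNormal (v : Plane) : Plane := ‖v‖⁻¹ • !₂[v 1, -v 0]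

theorem inner_rightNormal (v w : Plane) : inner ℝ w (rightNormal v) = -det2 v w / ‖v‖ := by
  rw [rightNormal, inner_smul_right, plane_inner, det2]
  simp
  ring

namespace IsBoundaryParam

variable {S : Set Plane} {T : ℝ}

theorem deriv_ne_zero (hγ : IsBoundaryParam S γ T) (t : ℝ) : deriv γ t ≠ 0 := by
  intro h
  have := hγ.curvature_pos t
  rw [h] at this
  simp [det2] at this

theorem mem_frontier (hγ : IsBoundaryParam S γ T) (t : ℝ) : γ t ∈ frontier S :=
  hγ.range_eq ▸ mem_range_self t

/-- The only outward unit normal is the right normal of the tangent vector: the derivative of the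
distance to the supporting line vanishes, and the sign of its second derivative, compared with the
sign of the curvature, tells on which side of the tangent the shape lies. -/
theorem normal_eq (hγ : IsBoundaryParam S γ T) (hc : IsClosed S) {t : ℝ} {n : Plane}
    (hn : IsNormal S (γ t) n) : n = rightNormal (deriv γ t) := by
  have hle : ∀ s, inner ℝ (γ s - γ t) n ≤ 0 := fun s =>
    hn.2 _ (hc.frontier_subset (hγ.mem_frontier s))
  have h0 : inner ℝ (deriv γ t) n = 0 := by
    have hd : HasDerivAt (fun s => inner ℝ (γ s - γ t) n) (inner ℝ (deriv γ t) n) t := by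
      have h1 := ((hasDerivAt_of_contDiff hγ.contDiff t).sub_const (γ t)).inner ℝ
        (hasDerivAt_const t n)
      simpa using h1
    have hmax : IsLocalMax (fun s => inner ℝ (γ s - γ t) n) t :=
      Eventually.of_forall fun s => by simpa using hle s
    exact hmax.hasDerivAt_eq_zero hd
  have h2 : inner ℝ (deriv (deriv γ) t) n ≤ 0 := by
    have hcont : Tendsto (fun u => inner ℝ (taylorRem γ t u) n) (𝓝[≠] 0)
        (𝓝 (inner ℝ (taylorRem γ t 0) n)) := by
      have h1 := (continuous_taylorRem hγ.contDiff).comp (Continuous.prodMk_right t)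
      have h2 : Continuous (fun u => inner ℝ (taylorRem γ t u) n) :=
        Continuous.inner h1 continuous_const
      exact h2.continuousAt.tendsto.mono_left nhdsWithin_le_nhds
    have : inner ℝ (taylorRem γ t 0) n ≤ 0 := by
      refine le_of_tendsto hcont ?_
      filter_upwards [self_mem_nhdsWithin] with u hu
      have h3 := hle (t + u)
      rw [taylor_two hγ.contDiff, inner_add_left, inner_smul_left, inner_smul_left, h0] at h3
      simp at h3
      have : 0 < u ^ 2 := by positivity [show u ≠ 0 from hu]
      nlinarith
    rw [taylorRem_zero, inner_smul_left] at this
    simp at this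
    linarith
  have hv := hγ.deriv_ne_zero t
  have hκ := hγ.curvature_pos t
  have hn1 := hn.1
  have hnn := plane_norm_sq n
  have hvv := plane_norm_sq (deriv γ t)
  have hvpos : 0 < ‖deriv γ t‖ := norm_pos_iff.2 hv
  rw [plane_inner] at h0 h2
  rw [hn1] at hnn
  rw [det2] at hκ
  generalize deriv (deriv γ) t = a at *
  generalize deriv γ t = v at *
  generalize hL : ‖v‖ = L at *
  set k := n 0 * v 1 - n 1 * v 0 with hk
  have e0 : n 0 * L ^ 2 = k * v 1 := by rw [hvv, hk]; linear_combination (v 0) * h0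
  have e1 : n 1 * L ^ 2 = - (k * v 0) := by rw [hvv, hk]; linear_combination (v 1) * h0
  have hk2 : k ^ 2 = L ^ 2 := by
    have : k ^ 2 * L ^ 2 = L ^ 2 * L ^ 2 := by
      calc k ^ 2 * L ^ 2 = (k * v 1) ^ 2 + (- (k * v 0)) ^ 2 := by rw [hvv]; ring
        _ = (n 0 ^ 2 + n 1 ^ 2) * (L ^ 2 * L ^ 2) := by rw [← e0, ← e1]; ring
        _ = _ := by rw [← hnn]; ring
    exact mul_right_cancel₀ (by positivity) this
  have hk0 : 0 ≤ k := by
    by_contra hneg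
    push Not at hneg
    have : (a 0 * n 0 + a 1 * n 1) * L ^ 2 = -k * (v 0 * a 1 - v 1 * a 0) := by
      linear_combination a 0 * e0 + a 1 * e1
    have h5 : 0 < -k * (v 0 * a 1 - v 1 * a 0) := mul_pos (by linarith) hκ
    have h6 : (a 0 * n 0 + a 1 * n 1) * L ^ 2 ≤ 0 :=
      mul_nonpos_of_nonpos_of_nonneg h2 (by positivity)
    linarith
  have hkL : k = L := by
    rw [← abs_of_nonneg hk0, ← abs_of_pos hvpos]; exact (sq_eq_sq_iff_abs_eq_abs _ _).1 hk2
  rw [rightNormal, hL]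
  apply plane_ext
  · simp; field_simp; rw [hkL] at e0
    exact mul_right_cancel₀ hvpos.ne' (by linear_combination e0)
  · simp; field_simp; rw [hkL] at e1
    exact mul_right_cancel₀ hvpos.ne' (by linear_combination e1)

theorem isNormal (hγ : IsBoundaryParam S γ T) (hc : IsClosed S) (hS : Convex ℝ S)
    (hi : (interior S).Nonempty) (t : ℝ) : IsNormal S (γ t) (rightNormal (deriv γ t)) := by
  obtain ⟨n, hn⟩ := exists_isNormal hS hi (hγ.mem_frontier t).2
  exact hγ.normal_eq hc hn ▸ hn

theorem eq_zero_of_eq (hγ : IsBoundaryParam S γ T) {t u : ℝ} (h : γ (t + u) = γ t)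
    (hu : |u| ≤ T / 2) : u = 0 := by
  have hT := hγ.period_pos
  obtain ⟨m, hm, -⟩ := existsUnique_add_zsmul_mem_Ico hT t 0
  obtain ⟨k, hk, -⟩ := existsUnique_add_zsmul_mem_Ico hT (t + u) 0
  simp only [zero_add] at hm hk
  have h1 := hγ.injOn hk hm (by rw [hγ.periodic.zsmul, hγ.periodic.zsmul, h])
  simp only [zsmul_eq_mul] at h1
  have h2 : u = ((m - k : ℤ) : ℝ) * T := by push_cast; linarith
  rcases eq_or_ne (m - k) 0 with h3 | h3
  · rw [h2, h3]; simp
  · exfalso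
    have h4 : (1 : ℝ) ≤ |((m - k : ℤ) : ℝ)| := by
      exact_mod_cast Int.one_le_abs h3
    rw [h2, abs_mul, abs_of_pos hT] at hu
    nlinarith

theorem frontier_eq_image (hγ : IsBoundaryParam S γ T) (a : ℝ) {Y : Plane} (hY : Y ∈ frontier S) :
    ∃ s ∈ Ico a (a + T), γ s = Y := by
  rw [← hγ.range_eq] at hY
  obtain ⟨s, rfl⟩ := hY
  obtain ⟨y, hy, h⟩ := hγ.periodic.exists_mem_Ico hγ.period_pos s a
  exact ⟨y, hy, h.symm⟩

/-- The tangent line touches the shape at one point only. Otherwise it contains a segment of the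
boundary, whose parameters accumulate at a point where the positive curvature forbids it. -/
theorem inner_neg (hγ : IsBoundaryParam S γ T) (hc : IsClosed S) (hS : Convex ℝ S)
    {t s : ℝ} {n : Plane} (hn : IsNormal S (γ t) n) (hne : γ s ≠ γ t) :
    inner ℝ (γ s - γ t) n < 0 := by
  have hmem : ∀ s, γ s ∈ S := fun s => hc.frontier_subset (hγ.mem_frontier s)
  refine lt_of_le_of_ne (hn.2 _ (hmem s)) fun h0 => ?_
  have hex : ∀ l : Icc (0 : ℝ) 1, ∃ τ ∈ Ico 0 T, γ τ = γ t + (l : ℝ) • (γ s - γ t) := by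
    rintro ⟨l, hl⟩
    have hin : γ t + l • (γ s - γ t) ∈ S := hS.add_smul_sub_mem (hmem t) (hmem s) hl
    have hfr : γ t + l • (γ s - γ t) ∈ frontier S := by
      refine ⟨subset_closure hin, hn.notMem_interior ?_⟩
      rw [add_sub_cancel_left, inner_smul_left, h0, mul_zero]
    simpa using hγ.frontier_eq_image 0 hfr
  choose τ hτ hτe using hex
  have hinj : Function.Injective τ := by
    intro a b hab
    have h1 := hτe a
    rw [hab, hτe b] at h1
    have h2 : ((b : ℝ) - a) • (γ s - γ t) = 0 := by
      rw [sub_smul, sub_eq_zero]; exact add_left_cancel h1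
    rcases smul_eq_zero.1 h2 with h3 | h3
    · exact Subtype.ext (by linarith)
    · exact absurd (sub_eq_zero.1 h3) hne
  have : Infinite (Icc (0 : ℝ) 1) := (Icc_infinite zero_lt_one).to_subtype
  obtain ⟨x, -, hx⟩ := (infinite_range_of_injective hinj).exists_accPt_of_subset_isCompact
    (isCompact_Icc (a := 0) (b := T)) (by rintro _ ⟨l, rfl⟩; exact Ico_subset_Icc_self (hτ l))
  rw [accPt_iff_frequently] at hx
  have hzero : ∀ y ∈ range τ, inner ℝ (γ y - γ t) n = 0 := by
    rintro _ ⟨l, rfl⟩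
    rw [hτe, add_sub_cancel_left, inner_smul_left, h0, mul_zero]
  have hcont : Continuous fun y => inner ℝ (γ y - γ t) n :=
    (hγ.contDiff.continuous.sub continuous_const).inner continuous_const
  have hx0 : inner ℝ (γ x - γ t) n = 0 := by
    have hcl : IsClosed {y | inner ℝ (γ y - γ t) n = 0} := isClosed_eq hcont continuous_const
    exact hcl.mem_of_frequently_of_tendsto (hx.mono fun y hy => hzero y hy.2) tendsto_id
  have hnx : IsNormal S (γ x) n := by
    refine ⟨hn.1, fun Y hY => ?_⟩
    have := hn.2 Y hY
    rw [show Y - γ x = (Y - γ t) - (γ x - γ t) by abel, inner_sub_left, hx0]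
    linarith
  have hnr := hγ.normal_eq hc hnx
  have hvpos : 0 < ‖deriv γ x‖ := norm_pos_iff.2 (hγ.deriv_ne_zero x)
  have hd0 : inner ℝ (deriv γ x) n = 0 := by
    rw [hnr, inner_rightNormal, det2]; ring
  have hG0 : inner ℝ (taylorRem γ x 0) n < 0 := by
    rw [taylorRem_zero, inner_smul_left, hnr, inner_rightNormal]
    have := div_pos (hγ.curvature_pos x) hvpos
    simp
    rw [neg_div]; linarith
  have hGc : Continuous fun u => inner ℝ (taylorRem γ x u) n :=
    ((continuous_taylorRem hγ.contDiff).comp (Continuous.prodMk_right x)).inner continuous_const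
  have hev : ∀ᶠ y in 𝓝 x, inner ℝ (taylorRem γ x (y - x)) n < 0 := by
    have h1 : Continuous fun y => inner ℝ (taylorRem γ x (y - x)) n :=
      hGc.comp (continuous_sub_right x)
    exact h1.continuousAt.eventually_lt continuousAt_const (by simpa using hG0)
  obtain ⟨y, ⟨hyx, hyr⟩, hy⟩ := (hx.and_eventually hev).exists
  have h3 := hzero y hyr
  have h4 : inner ℝ (γ y - γ x) n = 0 := by
    rw [show γ y - γ x = (γ y - γ t) - (γ x - γ t) by abel, inner_sub_left, hx0, h3, sub_zero]
  have h5 := taylor_two hγ.contDiff x (y - x)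
  rw [add_sub_cancel] at h5
  rw [h5, inner_add_left, inner_smul_left, inner_smul_left, hd0] at h4
  simp at h4
  rcases h4 with h4 | h4
  · exact hyx (sub_eq_zero.1 h4)
  · linarith

end IsBoundaryParam

end

noncomputable section

/-! ### Inner and outer tangent discs -/

/-- `S` is a plane convex body such that, at every boundary point, some closed disc of radius `r`
that is tangent to the boundary lies in `S`, and `S` lies in a closed disc of radius `R` that is
tangent to the boundary. Tangent discs are those whose center is on the line of an outward unit
normal. -/
structure HasRollingDiscs (S : Set Plane) (r R : ℝ) : Prop where
  convex : Convex ℝ S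
  isCompact : IsCompact S
  nonempty_interior : (interior S).Nonempty
  r_pos : 0 < r
  R_pos : 0 < R
  inner_disc : ∀ M ∈ frontier S, ∀ n, IsNormal S M n → Metric.closedBall (M - r • n) r ⊆ S
  outer_disc : ∀ M ∈ frontier S, ∀ n, IsNormal S M n → ∀ Y ∈ S,
    ‖Y - M‖ ^ 2 ≤ 2 * R * inner ℝ (M - Y) n

/-- The squared length of a chord of the boundary and the distance of its end to the tangent at its
origin are comparable: both are `u ^ 2` times a positive continuous function of the parameters. -/
theorem IsBoundaryParam.exists_chord_bounds {S : Set Plane} {γ : ℝ → Plane} {T : ℝ}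
    (hγ : IsBoundaryParam S γ T) (hc : IsClosed S) (hS : Convex ℝ S)
    (hi : (interior S).Nonempty) :
    ∃ a b : ℝ, 0 < a ∧ 0 < b ∧ ∀ M ∈ frontier S, ∀ n, IsNormal S M n → ∀ Y ∈ frontier S,
      a * inner ℝ (M - Y) n ≤ ‖Y - M‖ ^ 2 ∧ ‖Y - M‖ ^ 2 ≤ b * inner ℝ (M - Y) n := by
  have hT := hγ.period_pos
  set H : ℝ × ℝ → ℝ := fun p =>
    det2 (deriv γ p.1) (taylorRem γ p.1 p.2) / ‖deriv γ p.1‖ with hH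
  set q : ℝ × ℝ → ℝ := fun p => ‖deriv γ p.1 + p.2 • taylorRem γ p.1 p.2‖ ^ 2 with hq
  have hGc := continuous_taylorRem hγ.contDiff
  have hdc := continuous_deriv_of_contDiff hγ.contDiff
  have hHc : Continuous H := by
    refine Continuous.div ?_ (by fun_prop) fun p => norm_ne_zero_iff.2 (hγ.deriv_ne_zero _)
    unfold det2
    fun_prop
  have hqc : Continuous q := by fun_prop
  have hn := hγ.isNormal hc hS hi
  have hv : ∀ t, 0 < ‖deriv γ t‖ := fun t => norm_pos_iff.2 (hγ.deriv_ne_zero t)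
  have hHe : ∀ t u, inner ℝ (γ t - γ (t + u)) (rightNormal (deriv γ t)) = u ^ 2 * H (t, u) := by
    intro t u
    rw [← neg_sub (γ (t + u)), taylor_two hγ.contDiff, inner_neg_left, inner_rightNormal, hH]
    simp only [det2, PiLp.add_apply, PiLp.smul_apply, smul_eq_mul]
    ring
  have hqe : ∀ t u, ‖γ (t + u) - γ t‖ ^ 2 = u ^ 2 * q (t, u) := by
    intro t u
    rw [taylor_two hγ.contDiff, hq, sq u, ← smul_smul, ← smul_add, norm_smul, mul_pow,
      Real.norm_eq_abs, sq_abs]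
    ring
  have hpos : ∀ p ∈ Icc 0 T ×ˢ Icc (-(T / 2)) (T / 2), 0 < H p ∧ 0 < q p := by
    rintro ⟨t, u⟩ ⟨-, hu⟩
    rcases eq_or_ne u 0 with rfl | hu0
    · constructor
      · simp only [hH, taylorRem_zero]
        apply div_pos _ (hv t)
        have := hγ.curvature_pos t
        rw [det2] at this ⊢
        simp only [PiLp.smul_apply, smul_eq_mul]
        linarith
      · have := hv t
        simp only [hq, zero_smul, add_zero]
        positivity
    · have hne : γ (t + u) ≠ γ t := fun h => hu0 (hγ.eq_zero_of_eq h (abs_le.2 hu))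
      have h1 := hγ.inner_neg hc hS (hn t) hne
      rw [← neg_sub (γ t), inner_neg_left, hHe] at h1
      have hu2 : 0 < u ^ 2 := by positivity
      have h3 : 0 < ‖γ (t + u) - γ t‖ ^ 2 := by
        have := norm_pos_iff.2 (sub_ne_zero.2 hne)
        positivity
      rw [hqe] at h3
      exact ⟨by simpa [hu2] using h1, (mul_pos_iff_of_pos_left hu2).1 h3⟩
  have hcomp : IsCompact (Icc 0 T ×ˢ Icc (-(T / 2)) (T / 2)) := isCompact_Icc.prod isCompact_Icc
  have hne : (Icc 0 T ×ˢ Icc (-(T / 2)) (T / 2)).Nonempty :=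
    ⟨(0, 0), left_mem_Icc.2 hT.le, by constructor <;> simp only <;> linarith⟩
  have hratio : ContinuousOn (fun p => q p / H p) (Icc 0 T ×ˢ Icc (-(T / 2)) (T / 2)) :=
    hqc.continuousOn.div hHc.continuousOn fun p hp => (hpos p hp).1.ne'
  obtain ⟨p₁, hp₁, hmin⟩ := hcomp.exists_isMinOn hne hratio
  obtain ⟨p₂, hp₂, hmax⟩ := hcomp.exists_isMaxOn hne hratio
  refine ⟨q p₁ / H p₁, q p₂ / H p₂, div_pos (hpos _ hp₁).2 (hpos _ hp₁).1,
    div_pos (hpos _ hp₂).2 (hpos _ hp₂).1, fun M hM n hnM Y hY => ?_⟩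
  obtain ⟨t, ht, rfl⟩ := hγ.frontier_eq_image 0 hM
  obtain ⟨s, hs, rfl⟩ := hγ.frontier_eq_image (t - T / 2) hY
  obtain ⟨u, rfl⟩ : ∃ u, s = t + u := ⟨s - t, by ring⟩
  have hp : (t, u) ∈ Icc 0 T ×ˢ Icc (-(T / 2)) (T / 2) :=
    ⟨⟨ht.1, by linarith [ht.2]⟩, ⟨by linarith [hs.1], by linarith [hs.2]⟩⟩
  rw [hγ.normal_eq hc hnM, hHe, hqe]
  have hHp := (hpos _ hp).1
  have h1 : q p₁ / H p₁ ≤ q (t, u) / H (t, u) := hmin hp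
  have h2 : q (t, u) / H (t, u) ≤ q p₂ / H p₂ := hmax hp
  rw [le_div_iff₀ hHp] at h1
  rw [div_le_iff₀ hHp] at h2
  constructor
  · nlinarith [sq_nonneg u]
  · nlinarith [sq_nonneg u]

/-- A ball contains a compact set as soon as it contains its boundary. -/
theorem subset_closedBall_of_frontier {S : Set Plane} (hS : IsCompact S) {x : Plane} {R : ℝ}
    (hR : 0 ≤ R) (h : frontier S ⊆ Metric.closedBall x R) : S ⊆ Metric.closedBall x R := by
  intro Y hY
  obtain ⟨y, hy, hmax⟩ := hS.exists_isMaxOn ⟨Y, hY⟩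
    (Continuous.continuousOn (f := fun y => dist y x) (by fun_prop))
  have hYy : dist Y x ≤ dist y x := hmax hY
  refine Metric.mem_closedBall.2 (hYy.trans ?_)
  by_cases hf : y ∈ frontier S
  · exact Metric.mem_closedBall.1 (h hf)
  have hyi : y ∈ interior S := by
    by_contra hni
    exact hf ⟨subset_closure hy, hni⟩
  rcases eq_or_ne y x with rfl | hyx
  · simpa using hR
  exfalso
  have hcont : Tendsto (fun ε : ℝ => y + ε • (y - x)) (𝓝[>] 0) (𝓝 y) := by
    have : Continuous fun ε : ℝ => y + ε • (y - x) := by fun_prop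
    simpa using (this.tendsto 0).mono_left nhdsWithin_le_nhds
  obtain ⟨ε, hε, hε0⟩ := ((hcont.eventually (isOpen_interior.mem_nhds hyi)).and
    self_mem_nhdsWithin).exists
  have h1 : dist (y + ε • (y - x)) x ≤ dist y x := hmax (interior_subset hε)
  rw [dist_eq_norm, dist_eq_norm, show y + ε • (y - x) - x = (1 + ε) • (y - x) by module,
    norm_smul, Real.norm_eq_abs, abs_of_pos (by linarith [show (0 : ℝ) < ε from hε0])] at h1
  have h2 : 0 < ‖y - x‖ := norm_pos_iff.2 (sub_ne_zero.2 hyx)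
  nlinarith [show (0 : ℝ) < ε from hε0]

theorem exists_hasRollingDiscs {S : Set Plane} (h : S ∈ ConvexC3Shapes) :
    ∃ r R, HasRollingDiscs S r R := by
  obtain ⟨hS, hcomp, hi, γ, T, hγ⟩ := h
  have hc := hcomp.isClosed
  obtain ⟨a, b, ha, hb, hab⟩ := hγ.exists_chord_bounds hc hS hi
  refine ⟨a / 2, b / 2, hS, hcomp, hi, by positivity, by positivity, ?_, ?_⟩
  · intro M hM n hn
    have hdisj : ∀ Y ∈ Metric.ball (M - (a / 2) • n) (a / 2), Y ∉ frontier S := by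
      intro Y hY hYf
      have h1 := (hab M hM n hn Y hYf).1
      rw [Metric.mem_ball, dist_eq_norm, show Y - (M - (a / 2) • n) = (Y - M) + (a / 2) • n by
        module] at hY
      have h2 : ‖(Y - M) + (a / 2) • n‖ ^ 2 < (a / 2) ^ 2 := by
        have := norm_nonneg ((Y - M) + (a / 2) • n)
        nlinarith
      rw [norm_add_sq_real, inner_smul_right, norm_smul, hn.1, mul_one, Real.norm_eq_abs,
        sq_abs] at h2
      rw [← neg_sub Y M, inner_neg_left] at h1
      linarith
    obtain ⟨c, hci⟩ := hi
    have hcn := hn.inner_neg hci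
    -- The points of the segment from `M` to `c` that are close to `M` are in the disc and in `S`.
    obtain ⟨Y, hYS, hYb⟩ : ∃ Y ∈ S, Y ∈ Metric.ball (M - (a / 2) • n) (a / 2) := by
      have hcM : 0 < ‖c - M‖ := by
        rw [norm_pos_iff]; intro h0; rw [h0] at hcn; simp at hcn
      set ε : ℝ := min 1 (a * (-inner ℝ (c - M) n) / (2 * ‖c - M‖ ^ 2)) with hε
      have hε0 : 0 < ε := lt_min one_pos (div_pos (mul_pos ha (by linarith)) (by positivity))
      have hε1 : ε ≤ 1 := min_le_left _ _
      have hε2 : ε * (2 * ‖c - M‖ ^ 2) ≤ a * (-inner ℝ (c - M) n) := by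
        rw [← le_div_iff₀ (by positivity)]; exact min_le_right _ _
      refine ⟨M + ε • (c - M), hS.add_smul_sub_mem (hc.frontier_subset hM)
        (interior_subset hci) ⟨hε0.le, hε1⟩, ?_⟩
      rw [Metric.mem_ball, dist_eq_norm,
        show M + ε • (c - M) - (M - (a / 2) • n) = ε • (c - M) + (a / 2) • n by module]
      refine lt_of_pow_lt_pow_left₀ 2 (by positivity) ?_
      rw [norm_add_sq_real, inner_smul_right, inner_smul_left, norm_smul, norm_smul, hn.1, mul_one,
        Real.norm_eq_abs, Real.norm_eq_abs, sq_abs, mul_pow, sq_abs]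
      simp only [conj_trivial]
      have h7 : 0 < ε * (a * (-inner ℝ (c - M) n)) :=
        mul_pos hε0 (mul_pos ha (by linarith))
      have h8 := mul_le_mul_of_nonneg_left hε2 hε0.le
      linarith
    have hball : Metric.ball (M - (a / 2) • n) (a / 2) ⊆ S := by
      intro Z hZ
      by_contra hZS
      obtain ⟨z, hz, hzf⟩ := (convex_ball (M - (a / 2) • n)
        (a / 2)).isPreconnected.exists_mem_frontier hYb hYS hZ hZS
      exact hdisj z hz hzf
    rw [← closure_ball _ (by positivity : a / 2 ≠ 0)]
    exact closure_minimal hball hc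
  · intro M hM n hn Y hY
    have key : ∀ Y, ‖Y - (M - (b / 2) • n)‖ ^ 2
        = ‖Y - M‖ ^ 2 - b * inner ℝ (M - Y) n + (b / 2) ^ 2 := by
      intro Y
      rw [show Y - (M - (b / 2) • n) = (Y - M) + (b / 2) • n by module, norm_add_sq_real,
        inner_smul_right, norm_smul, hn.1, mul_one, Real.norm_eq_abs, sq_abs, ← neg_sub Y M,
        inner_neg_left]
      ring
    have h1 : S ⊆ Metric.closedBall (M - (b / 2) • n) (b / 2) := by
      apply subset_closedBall_of_frontier hcomp (by positivity)
      intro Z hZ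
      rw [Metric.mem_closedBall, dist_eq_norm]
      refine le_of_sq_le_sq ?_ (by positivity)
      rw [key]
      linarith [(hab M hM n hn Z hZ).2]
    have h2 := h1 hY
    rw [Metric.mem_closedBall, dist_eq_norm] at h2
    have h3 := pow_le_pow_left₀ (norm_nonneg _) h2 2
    rw [key] at h3
    linarith

theorem IsTangent.isNormal {S : Set Plane} (h : S ∈ ConvexC3Shapes) {M v : Plane}
    (hv : IsTangent S M v) : v ≠ 0 ∧ M ∈ frontier S ∧ IsNormal S M (rightNormal v) := by
  obtain ⟨γ, T, t, hγ, rfl, rfl⟩ := hv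
  exact ⟨hγ.deriv_ne_zero t, hγ.mem_frontier t,
    hγ.isNormal h.2.1.isClosed h.1 h.2.2.1 t⟩

namespace HasRollingDiscs

variable {S : Set Plane} {r R : ℝ}

theorem isClosed (hS : HasRollingDiscs S r R) : IsClosed S := hS.isCompact.isClosed

/-- The point with outward normal `m` of the inner disc at `M` is on the inner side of the supporting
line at `N`. -/
theorem inner_sub_le (hS : HasRollingDiscs S r R) {M N n m : Plane} (hM : M ∈ frontier S)
    (hn : IsNormal S M n) (hm : IsNormal S N m) :
    r * (1 - inner ℝ n m) ≤ inner ℝ (N - M) m := by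
  have h1 : M - r • n + r • m ∈ S := by
    apply hS.inner_disc M hM n hn
    rw [Metric.mem_closedBall, dist_eq_norm, add_sub_cancel_left, norm_smul, hm.1,
      Real.norm_eq_abs, abs_of_pos hS.r_pos, mul_one]
  have h2 := hm.2 _ h1
  rw [show M - r • n + r • m - N = -(N - M) - r • n + r • m by abel, inner_add_left,
    inner_sub_left, inner_smul_left, inner_smul_left, real_inner_self_eq_norm_sq, hm.1,
    inner_neg_left] at h2
  simp at h2
  linarith

/-- The outward unit normal is a Lipschitz function of the boundary point. -/
theorem norm_normal_sub_le (hS : HasRollingDiscs S r R) {M N n m : Plane} (hM : M ∈ frontier S)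
    (hN : N ∈ frontier S) (hn : IsNormal S M n) (hm : IsNormal S N m) :
    r * ‖n - m‖ ≤ ‖M - N‖ := by
  have h1 := hS.inner_sub_le hM hn hm
  have h2 := hS.inner_sub_le hN hm hn
  have h3 : ‖n - m‖ ^ 2 = 2 * (1 - inner ℝ n m) := by
    rw [norm_sub_sq_real, hn.1, hm.1]; ring
  have h4 : inner ℝ (M - N) (n - m) ≤ ‖M - N‖ * ‖n - m‖ := real_inner_le_norm _ _
  rw [real_inner_comm n m] at h2
  rw [← neg_sub M N, inner_neg_left] at h1
  rw [inner_sub_right] at h4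
  have h5 : (r * ‖n - m‖) * ‖n - m‖ ≤ ‖M - N‖ * ‖n - m‖ := by
    rw [mul_assoc, ← sq, h3]
    linarith
  rcases (norm_nonneg (n - m)).eq_or_lt with h0 | h0
  · rw [← h0, mul_zero]; exact norm_nonneg _
  · exact le_of_mul_le_mul_right h5 h0

/-- A chord whose point dividing it in the ratio `b : a` is close to the complement of `S` is
short. -/
theorem chord_sq_le (hS : HasRollingDiscs S r R) {P₀ P₁ Q : Plane} (h₀ : P₀ ∈ S) (h₁ : P₁ ∈ S)
    {a b ρ : ℝ} (ha : 0 ≤ a) (hb : 0 ≤ b) (hab : a + b = 1) (hQ : Q ∉ S)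
    (hρ : ‖Q - (a • P₀ + b • P₁)‖ ≤ ρ) : a * b * ‖P₁ - P₀‖ ^ 2 ≤ 2 * R * ρ := by
  set Z := a • P₀ + b • P₁ with hZ
  have hZS : Z ∈ S := hS.convex h₀ h₁ ha hb hab
  obtain ⟨M, hM, hMf⟩ := exists_mem_segment_frontier hZS hQ
  obtain ⟨n, hn⟩ := exists_isNormal hS.convex hS.nonempty_interior hMf.2
  have hZM : ‖M - Z‖ ≤ ρ := by
    rw [segment_eq_image'] at hM
    obtain ⟨θ, hθ, rfl⟩ := hM
    simp only [add_sub_cancel_left]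
    rw [norm_smul, Real.norm_eq_abs, abs_of_nonneg hθ.1]
    nlinarith [norm_nonneg (Q - Z), hθ.2]
  have e0 := hS.outer_disc M hMf n hn P₀ h₀
  have e1 := hS.outer_disc M hMf n hn P₁ h₁
  have h2 : inner ℝ (M - Z) n ≤ ρ := by
    have := real_inner_le_norm (M - Z) n
    rw [hn.1, mul_one] at this
    exact this.trans hZM
  have h3 : inner ℝ (M - Z) n = a * inner ℝ (M - P₀) n + b * inner ℝ (M - P₁) n := by
    obtain rfl : a = 1 - b := by linarith
    rw [hZ, show M - ((1 - b) • P₀ + b • P₁) = (1 - b) • (M - P₀) + b • (M - P₁) by module,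
      inner_add_left, inner_smul_left, inner_smul_left]
    simp
  -- Stewart's identity for the point `M` and the segment from `P₀` to `P₁`
  have h4 : a * ‖P₀ - M‖ ^ 2 + b * ‖P₁ - M‖ ^ 2 = ‖Z - M‖ ^ 2 + a * b * ‖P₁ - P₀‖ ^ 2 := by
    obtain rfl : a = 1 - b := by linarith
    simp only [plane_norm_sq, hZ, PiLp.sub_apply, PiLp.add_apply, PiLp.smul_apply, smul_eq_mul]
    ring
  have hR := hS.R_pos
  nlinarith [mul_le_mul_of_nonneg_left e0 ha, mul_le_mul_of_nonneg_left e1 hb,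
    sq_nonneg ‖Z - M‖]

end HasRollingDiscs

end

noncomputable section

/-! ### Gauss digitizations and their convex hulls -/

@[simp] theorem gridPt_zero_coord (h : ℝ) (k : ℤ × ℤ) : gridPt h k 0 = h * k.1 := by simp [gridPt]

@[simp] theorem gridPt_one_coord (h : ℝ) (k : ℤ × ℤ) : gridPt h k 1 = h * k.2 := by simp [gridPt]

theorem gridPt_add (h : ℝ) (k l : ℤ × ℤ) : gridPt h (k + l) = gridPt h k + gridPt h l := by
  apply plane_ext <;> simp <;> ring

theorem gridPt_sub (h : ℝ) (k l : ℤ × ℤ) : gridPt h (k - l) = gridPt h k - gridPt h l := by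
  apply plane_ext <;> simp <;> ring

theorem gridPt_zsmul (h : ℝ) (m : ℤ) (k : ℤ × ℤ) : gridPt h (m • k) = (m : ℝ) • gridPt h k := by
  apply plane_ext <;> simp <;> ring

theorem gridPt_injective {h : ℝ} (hh : 0 < h) : Function.Injective (gridPt h) := by
  intro k l hkl
  have h0 : gridPt h k 0 = gridPt h l 0 := by rw [hkl]
  have h1 : gridPt h k 1 = gridPt h l 1 := by rw [hkl]
  simp [hh.ne'] at h0 h1
  exact Prod.ext h0 h1

theorem le_norm_gridPt {h : ℝ} {k : ℤ × ℤ} (hk : k ≠ 0) : h ≤ ‖gridPt h k‖ := by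
  refine le_of_sq_le_sq ?_ (norm_nonneg _)
  rw [plane_norm_sq, gridPt_zero_coord, gridPt_one_coord]
  have h1 : (1 : ℝ) ≤ (k.1 : ℝ) ^ 2 + (k.2 : ℝ) ^ 2 := by
    have : (1 : ℤ) ≤ k.1 ^ 2 + k.2 ^ 2 := by
      by_contra hcon
      have h2 : k.1 ^ 2 + k.2 ^ 2 = 0 := by nlinarith [sq_nonneg k.1, sq_nonneg k.2]
      have h3 : k.1 = 0 := by nlinarith [sq_nonneg k.1, sq_nonneg k.2]
      have h4 : k.2 = 0 := by nlinarith [sq_nonneg k.1, sq_nonneg k.2]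
      exact hk (Prod.ext h3 h4)
    exact_mod_cast this
  nlinarith [sq_nonneg h]

theorem abs_coord_le_norm (a : Plane) (i : Fin 2) : |a i| ≤ ‖a‖ := by
  simpa using PiLp.norm_apply_le a i

theorem finite_gaussDig {h : ℝ} (hh : 0 < h) {S : Set Plane} (hS : Bornology.IsBounded S) :
    (gaussDig h S).Finite := by
  obtain ⟨B, hB⟩ := hS.subset_closedBall 0
  have hfin : (Icc (-⌈B / h⌉) ⌈B / h⌉ ×ˢ Icc (-⌈B / h⌉) ⌈B / h⌉ : Set (ℤ × ℤ)).Finite :=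
    (finite_Icc _ _).prod (finite_Icc _ _)
  refine (hfin.image (gridPt h)).subset ?_
  rintro _ ⟨hP, k, rfl⟩
  have hn : ‖gridPt h k‖ ≤ B := by simpa using hB hP
  have key : ∀ m : ℤ, |h * m| ≤ B → m ∈ Icc (-⌈B / h⌉) ⌈B / h⌉ := by
    intro m hm
    rw [abs_mul, abs_of_pos hh, ← le_div_iff₀' hh] at hm
    have h2 := hm.trans (Int.le_ceil (B / h))
    rw [abs_le] at h2
    constructor
    · exact_mod_cast h2.1
    · exact_mod_cast h2.2
  refine ⟨k, ⟨key _ ?_, key _ ?_⟩, rfl⟩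
  · simpa using (abs_coord_le_norm (gridPt h k) 0).trans hn
  · simpa using (abs_coord_le_norm (gridPt h k) 1).trans hn

theorem convexHull_gaussDig_subset {S : Set Plane} (hS : Convex ℝ S) (h : ℝ) :
    convexHull ℝ (gaussDig h S) ⊆ S :=
  convexHull_min inter_subset_left hS

/-- A point at distance at least `2 * h` from the complement of `S` is in the convex hull of the
digitization, because `S` contains the four vertices of its grid square. -/
theorem mem_convexHull_gaussDig {h : ℝ} (hh : 0 < h) {S : Set Plane} {Z : Plane}
    (hZ : Metric.closedBall Z (2 * h) ⊆ S) : Z ∈ convexHull ℝ (gaussDig h S) := by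
  set k := ⌊Z 0 / h⌋ with hk
  set l := ⌊Z 1 / h⌋ with hl
  set a := Z 0 / h - k with ha
  set b := Z 1 / h - l with hb
  have ha0 : 0 ≤ a := Int.fract_nonneg _
  have ha1 : a ≤ 1 := (Int.fract_lt_one _).le
  have hb0 : 0 ≤ b := Int.fract_nonneg _
  have hb1 : b ≤ 1 := (Int.fract_lt_one _).le
  have hZ0 : Z 0 = h * (k + a) := by rw [ha]; field_simp; ring
  have hZ1 : Z 1 = h * (l + b) := by rw [hb]; field_simp; ring
  have hcorner : ∀ i j : ℤ, 0 ≤ i → i ≤ 1 → 0 ≤ j → j ≤ 1 →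
      gridPt h (k + i, l + j) ∈ convexHull ℝ (gaussDig h S) := by
    intro i j hi0 hi1 hj0 hj1
    refine subset_convexHull ℝ _ ⟨hZ ?_, mem_range_self _⟩
    rw [Metric.mem_closedBall, dist_eq_norm]
    refine le_of_sq_le_sq ?_ (by positivity)
    rw [plane_norm_sq]
    simp only [PiLp.sub_apply, gridPt_zero_coord, gridPt_one_coord, hZ0, hZ1]
    push_cast
    have hi0' : (0 : ℝ) ≤ i := by exact_mod_cast hi0
    have hi1' : (i : ℝ) ≤ 1 := by exact_mod_cast hi1
    have hj0' : (0 : ℝ) ≤ j := by exact_mod_cast hj0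
    have hj1' : (j : ℝ) ≤ 1 := by exact_mod_cast hj1
    have e1 : ((i : ℝ) - a) ^ 2 ≤ 1 := by
      rw [sq_le_one_iff_abs_le_one, abs_le]; constructor <;> linarith
    have e2 : ((j : ℝ) - b) ^ 2 ≤ 1 := by
      rw [sq_le_one_iff_abs_le_one, abs_le]; constructor <;> linarith
    have : (h * (k + i) - h * (k + a)) ^ 2 + (h * (l + j) - h * (l + b)) ^ 2
        = h ^ 2 * ((i - a) ^ 2 + (j - b) ^ 2) := by ring
    rw [this]
    nlinarith [sq_nonneg h]
  have hconv := convex_convexHull ℝ (gaussDig h S)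
  have hbot := hconv (hcorner 0 0 (by simp) (by simp) (by simp) (by simp))
    (hcorner 1 0 (by simp) (by simp) (by simp) (by simp))
    (sub_nonneg.2 ha1) ha0 (by ring)
  have htop := hconv (hcorner 0 1 (by simp) (by simp) (by simp) (by simp))
    (hcorner 1 1 (by simp) (by simp) (by simp) (by simp))
    (sub_nonneg.2 ha1) ha0 (by ring)
  have hmid := hconv hbot htop (sub_nonneg.2 hb1) hb0 (by ring)
  convert hmid using 1
  apply plane_ext
  · simp only [PiLp.add_apply, PiLp.smul_apply, smul_eq_mul, gridPt_zero_coord]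
    rw [hZ0]; push_cast; ring
  · simp only [PiLp.add_apply, PiLp.smul_apply, smul_eq_mul, gridPt_one_coord]
    rw [hZ1]; push_cast; ring

theorem closedBall_subset_convexHull_gaussDig {h : ℝ} (hh : 0 < h) {S : Set Plane} {Z : Plane}
    {ρ : ℝ} (hZ : Metric.closedBall Z ρ ⊆ S) :
    Metric.closedBall Z (ρ - 2 * h) ⊆ convexHull ℝ (gaussDig h S) := by
  intro Y hY
  apply mem_convexHull_gaussDig hh
  refine (Metric.closedBall_subset_closedBall' ?_).trans hZ
  rw [Metric.mem_closedBall] at hY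
  linarith

/-- Boundary points of the convex hull of the digitization are close to the complement of the
shape. -/
theorem exists_notMem_of_notMem_interior {h : ℝ} (hh : 0 < h) {S : Set Plane} {X : Plane}
    (hX : X ∉ interior (convexHull ℝ (gaussDig h S))) : ∃ Q ∉ S, ‖Q - X‖ ≤ 3 * h := by
  by_contra! hcon
  refine hX (mem_interior.2 ⟨Metric.ball X h, ?_, Metric.isOpen_ball, Metric.mem_ball_self hh⟩)
  have h1 : Metric.closedBall X (3 * h) ⊆ S := by
    intro Q hQ
    by_contra hQS
    have := hcon Q hQS
    rw [Metric.mem_closedBall, dist_eq_norm] at hQ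
    linarith
  have h2 := closedBall_subset_convexHull_gaussDig hh h1
  rw [show 3 * h - 2 * h = h by ring] at h2
  exact Metric.ball_subset_closedBall.trans h2

/-! ### Edges of a digitization -/

theorem det2_smul_left (s : ℝ) (a b : Plane) : det2 (s • a) b = s * det2 a b := by
  simp [det2]; ring

variable {h : ℝ} {S : Set Plane} {e : (ℤ × ℤ) × (ℤ × ℤ)}

theorem fst_mem_of_mem_edges (he : e ∈ edges h (gaussDig h S)) : gridPt h e.1 ∈ gaussDig h S :=
  extremePoints_convexHull_subset he.2.1

theorem snd_mem_of_mem_edges (he : e ∈ edges h (gaussDig h S)) : gridPt h e.2 ∈ gaussDig h S :=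
  extremePoints_convexHull_subset he.2.2.1

theorem edgeVec_eq (h : ℝ) (e : (ℤ × ℤ) × (ℤ × ℤ)) : edgeVec h e = gridPt h (e.2 - e.1) := by
  rw [edgeVec, gridPt_sub]

theorem le_norm_edgeVec (he : e ∈ edges h (gaussDig h S)) : h ≤ ‖edgeVec h e‖ := by
  rw [edgeVec_eq]
  exact le_norm_gridPt (sub_ne_zero.2 he.1.symm)

theorem det2_edgeVec_nonneg (he : e ∈ edges h (gaussDig h S)) {Y : Plane}
    (hY : Y ∈ convexHull ℝ (gaussDig h S)) : 0 ≤ det2 (edgeVec h e) (Y - gridPt h e.1) := by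
  have hconv : Convex ℝ {Y : Plane | 0 ≤ det2 (edgeVec h e) (Y - gridPt h e.1)} := by
    intro A hA B hB a b ha hb hab
    simp only [mem_ofPred_eq] at *
    have : det2 (edgeVec h e) (a • A + b • B - gridPt h e.1)
        = a * det2 (edgeVec h e) (A - gridPt h e.1)
          + b * det2 (edgeVec h e) (B - gridPt h e.1) := by
      obtain rfl : a = 1 - b := by linarith
      simp [det2]; ring
    rw [this]
    positivity
  exact convexHull_min (fun P hP => he.2.2.2 P hP) hconv hY

theorem mem_segment_gridPt {X : Plane} (hX : X ∈ segment ℝ (gridPt h e.1) (gridPt h e.2)) :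
    ∃ θ ∈ Icc (0 : ℝ) 1, X = gridPt h e.1 + θ • edgeVec h e := by
  rw [segment_eq_image'] at hX
  obtain ⟨θ, hθ, rfl⟩ := hX
  exact ⟨θ, hθ, rfl⟩

theorem norm_rightNormal {v : Plane} (hv : v ≠ 0) : ‖rightNormal v‖ = 1 := by
  have hpos : 0 < ‖v‖ := norm_pos_iff.2 hv
  have h3 := plane_norm_sq v
  refine (sq_eq_sq₀ (norm_nonneg _) zero_le_one).1 ?_
  rw [rightNormal, norm_smul, mul_pow, plane_norm_sq, norm_inv, norm_norm]
  simp only [Matrix.cons_val_zero, Matrix.cons_val_one]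
  rw [inv_pow, inv_mul_eq_div, div_eq_iff (by positivity), h3]
  ring

theorem isNormal_edge (hh : 0 < h) (he : e ∈ edges h (gaussDig h S)) :
    IsNormal (convexHull ℝ (gaussDig h S)) (gridPt h e.1) (rightNormal (edgeVec h e)) := by
  refine ⟨norm_rightNormal fun h0 => ?_, fun Y hY => ?_⟩
  · exact norm_pos_iff.1 (hh.trans_le (le_norm_edgeVec he)) h0
  · rw [inner_rightNormal]
    exact div_nonpos_of_nonpos_of_nonneg (neg_nonpos.2 (det2_edgeVec_nonneg he hY))
      (norm_nonneg _)

theorem notMem_interior_of_mem_edge (hh : 0 < h) (he : e ∈ edges h (gaussDig h S)) {X : Plane}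
    (hX : X ∈ segment ℝ (gridPt h e.1) (gridPt h e.2)) :
    X ∉ interior (convexHull ℝ (gaussDig h S)) := by
  obtain ⟨θ, -, rfl⟩ := mem_segment_gridPt hX
  apply (isNormal_edge hh he).notMem_interior
  rw [inner_rightNormal, add_sub_cancel_left]
  simp [det2]
  left
  ring

/-- The primitive vector of the direction of an edge. -/
def edgePrim (e : (ℤ × ℤ) × (ℤ × ℤ)) : ℤ × ℤ :=
  ((e.2.1 - e.1.1) / edgeDelta e, (e.2.2 - e.1.2) / edgeDelta e)

theorem edgeDelta_zsmul_edgePrim (e : (ℤ × ℤ) × (ℤ × ℤ)) :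
    (edgeDelta e : ℤ) • edgePrim e = e.2 - e.1 := by
  apply Prod.ext
  · simpa [edgePrim, edgeDelta] using Int.mul_ediv_cancel' (Int.gcd_dvd_left _ _)
  · simpa [edgePrim, edgeDelta] using Int.mul_ediv_cancel' (Int.gcd_dvd_right _ _)

theorem edgeVec_eq_smul (h : ℝ) (e : (ℤ × ℤ) × (ℤ × ℤ)) :
    edgeVec h e = (edgeDelta e : ℝ) • gridPt h (edgePrim e) := by
  rw [edgeVec_eq, ← edgeDelta_zsmul_edgePrim, gridPt_zsmul]
  simp

theorem edgeDelta_pos (he : e ∈ edges h (gaussDig h S)) : 0 < edgeDelta e := by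
  rw [Nat.pos_iff_ne_zero]
  intro h0
  have := edgeDelta_zsmul_edgePrim e
  rw [h0] at this
  simp at this
  exact he.1 (sub_eq_zero.1 this.symm).symm

theorem edgePrim_ne_zero (he : e ∈ edges h (gaussDig h S)) : edgePrim e ≠ 0 := by
  intro h0
  have := edgeDelta_zsmul_edgePrim e
  rw [h0] at this
  simp at this
  exact he.1 (sub_eq_zero.1 this.symm).symm

/-- The next grid point on the line of an edge, beyond its end, is not in the shape, since the end
of the edge is extreme. -/
theorem snd_add_prim_notMem (hh : 0 < h) (he : e ∈ edges h (gaussDig h S)) :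
    gridPt h e.2 + gridPt h (edgePrim e) ∉ S := by
  intro hmem
  have hδ : (0 : ℝ) < edgeDelta e := by exact_mod_cast edgeDelta_pos he
  have h1 : gridPt h e.2 + gridPt h (edgePrim e) ∈ convexHull ℝ (gaussDig h S) :=
    subset_convexHull ℝ _ ⟨hmem, by rw [← gridPt_add]; exact mem_range_self _⟩
  have h2 : gridPt h e.2 ∈ openSegment ℝ (gridPt h e.1)
      (gridPt h e.2 + gridPt h (edgePrim e)) := by
    refine ⟨1 / (edgeDelta e + 1), edgeDelta e / (edgeDelta e + 1), by positivity, by positivity,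
      by field_simp; ring, ?_⟩
    have h3 : gridPt h e.1 = gridPt h e.2 - (edgeDelta e : ℝ) • gridPt h (edgePrim e) := by
      rw [← edgeVec_eq_smul, edgeVec]; abel
    rw [h3]
    apply plane_ext <;> simp <;> field_simp <;> ring
  have h4 := he.2.2.1.2 he.2.1.1 h1 h2
  have := gridPt_injective hh h4
  exact he.1 this

theorem fst_sub_prim_notMem (hh : 0 < h) (he : e ∈ edges h (gaussDig h S)) :
    gridPt h e.1 - gridPt h (edgePrim e) ∉ S := by
  intro hmem
  have hδ : (0 : ℝ) < edgeDelta e := by exact_mod_cast edgeDelta_pos he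
  have h1 : gridPt h e.1 - gridPt h (edgePrim e) ∈ convexHull ℝ (gaussDig h S) :=
    subset_convexHull ℝ _ ⟨hmem, by rw [← gridPt_sub]; exact mem_range_self _⟩
  have h2 : gridPt h e.1 ∈ openSegment ℝ (gridPt h e.2)
      (gridPt h e.1 - gridPt h (edgePrim e)) := by
    refine ⟨1 / (edgeDelta e + 1), edgeDelta e / (edgeDelta e + 1), by positivity, by positivity,
      by field_simp; ring, ?_⟩
    have h3 : gridPt h e.2 = gridPt h e.1 + (edgeDelta e : ℝ) • gridPt h (edgePrim e) := by
      rw [← edgeVec_eq_smul, edgeVec]; abel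
    rw [h3]
    apply plane_ext <;> simp <;> field_simp <;> ring
  have h4 := he.2.1.2 he.2.2.1.1 h1 h2
  have := gridPt_injective hh h4
  exact he.1 this.symm

theorem IsDown.norm_eq_one {v d : Plane} (hd : IsDown v d) : ‖d‖ = 1 := by
  refine (sq_eq_sq₀ (norm_nonneg _) zero_le_one).1 ?_
  rw [plane_norm_sq]
  rcases hd.1 with rfl | rfl | rfl | rfl <;> simp

namespace HasRollingDiscs

variable {r R : ℝ}

theorem exists_disc (hS : HasRollingDiscs S r R) :
    ∃ c D, 0 < D ∧ Metric.closedBall c r ⊆ S ∧ S ⊆ Metric.closedBall c D := by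
  have hne : (frontier S).Nonempty := by
    rw [nonempty_frontier_iff]
    exact ⟨hS.nonempty_interior.mono interior_subset, hS.isCompact.ne_univ⟩
  obtain ⟨M, hM⟩ := hne
  obtain ⟨n, hn⟩ := exists_isNormal hS.convex hS.nonempty_interior hM.2
  obtain ⟨D, hD0, hD⟩ := hS.isCompact.isBounded.subset_closedBall_lt 0 (M - r • n)
  exact ⟨M - r • n, D, hD0, hS.inner_disc M hM n hn, hD⟩

/-- The middle of an edge is close to the complement of the shape, so the edge is short. -/
theorem norm_edgeVec_sq_le (hS : HasRollingDiscs S r R) (hh : 0 < h)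
    (he : e ∈ edges h (gaussDig h S)) : ‖edgeVec h e‖ ^ 2 ≤ 24 * R * h := by
  have hX : (1 / 2 : ℝ) • gridPt h e.1 + (1 / 2 : ℝ) • gridPt h e.2
      ∈ segment ℝ (gridPt h e.1) (gridPt h e.2) :=
    ⟨1 / 2, 1 / 2, by norm_num, by norm_num, by norm_num, rfl⟩
  obtain ⟨Q, hQ, hQX⟩ := exists_notMem_of_notMem_interior hh (notMem_interior_of_mem_edge hh he hX)
  have := hS.chord_sq_le (fst_mem_of_mem_edges he).1 (snd_mem_of_mem_edges he).1
    (by norm_num) (by norm_num) (by norm_num) hQ hQX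
  rw [edgeVec]
  linarith

/-- Extending an edge to a chord of the shape at most triples its length, because the neighbouring
grid points on its line are not in the shape. The direction of the edge lies between the tangent
directions at the ends of that chord, so it is almost tangent there. -/
theorem exists_frontier_near_edge (hS : HasRollingDiscs S r R) (hh : 0 < h)
    (he : e ∈ edges h (gaussDig h S)) :
    ∃ A ∈ frontier S, ∃ n, IsNormal S A n ∧ ‖gridPt h e.1 - A‖ ≤ ‖edgeVec h e‖ ∧
      r * |inner ℝ (edgeVec h e) n| ≤ 3 * ‖edgeVec h e‖ ^ 2 := by
  obtain ⟨A, hA, hAf⟩ := exists_mem_segment_frontier (fst_mem_of_mem_edges he).1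
    (fst_sub_prim_notMem hh he)
  obtain ⟨B, hB, hBf⟩ := exists_mem_segment_frontier (snd_mem_of_mem_edges he).1
    (snd_add_prim_notMem hh he)
  obtain ⟨n, hn⟩ := exists_isNormal hS.convex hS.nonempty_interior hAf.2
  obtain ⟨m, hm⟩ := exists_isNormal hS.convex hS.nonempty_interior hBf.2
  rw [segment_eq_image'] at hA hB
  obtain ⟨α, hα, rfl⟩ := hA
  obtain ⟨β, hβ, rfl⟩ := hB
  have hδ : (1 : ℝ) ≤ edgeDelta e := by exact_mod_cast edgeDelta_pos he
  have hev := edgeVec_eq_smul h e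
  set w := gridPt h (edgePrim e) with hw
  set δ : ℝ := (edgeDelta e : ℝ) with hδe
  have hen : ‖edgeVec h e‖ = δ * ‖w‖ := by
    rw [hev, norm_smul, Real.norm_eq_abs, abs_of_pos (by linarith)]
  simp only [sub_sub_cancel_left, add_sub_cancel_left] at *
  set A := gridPt h e.1 + α • -w with hA
  set B := gridPt h e.2 + β • w with hB
  have hBA : B - A = (δ + α + β) • w := by
    rw [hA, hB, show gridPt h e.2 + β • w - (gridPt h e.1 + α • -w) =
      (gridPt h e.2 - gridPt h e.1) + (α + β) • w by module, ← edgeVec, hev]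
    module
  have hsum : 0 < δ + α + β := by linarith [hα.1, hβ.1]
  have h1 := hn.2 _ (hS.isClosed.frontier_subset hBf)
  have h2 := hm.2 _ (hS.isClosed.frontier_subset hAf)
  rw [← neg_sub B A, hBA, inner_neg_left, inner_smul_left] at h2
  rw [hBA, inner_smul_left] at h1
  simp only [conj_trivial] at h1 h2
  have h1' : inner ℝ w n ≤ 0 := by
    by_contra hc
    push Not at hc
    have := mul_pos hsum hc
    linarith
  have h2' : 0 ≤ inner ℝ w m := by
    by_contra hc
    push Not at hc
    have := mul_neg_of_pos_of_neg hsum hc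
    linarith
  have h3 := hS.norm_normal_sub_le hBf hAf hm hn
  rw [hBA, norm_smul, Real.norm_eq_abs, abs_of_pos hsum] at h3
  have h4 : inner ℝ w m - inner ℝ w n ≤ ‖w‖ * ‖m - n‖ := by
    rw [← inner_sub_right]; exact real_inner_le_norm _ _
  have hr := hS.r_pos
  have hw0 := norm_nonneg w
  refine ⟨A, hAf, n, hn, ?_, ?_⟩
  · rw [hA, sub_add_cancel_left, norm_neg, norm_smul, norm_neg, Real.norm_eq_abs,
      abs_of_nonneg hα.1, hen]
    exact mul_le_mul_of_nonneg_right (hα.2.trans hδ) hw0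
  · rw [hev, inner_smul_left, conj_trivial, abs_mul, abs_of_pos (by linarith : (0 : ℝ) < δ),
      abs_of_nonpos h1', ← hev, hen]
    have h5 : r * -inner ℝ w n ≤ ‖w‖ * (3 * δ * ‖w‖) := by
      calc r * -inner ℝ w n ≤ r * (‖w‖ * ‖m - n‖) := by
            apply mul_le_mul_of_nonneg_left _ hr.le; linarith
        _ = ‖w‖ * (r * ‖m - n‖) := by ring
        _ ≤ ‖w‖ * ((δ + α + β) * ‖w‖) := mul_le_mul_of_nonneg_left h3 hw0
        _ ≤ ‖w‖ * (3 * δ * ‖w‖) := by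
            gcongr
            linarith [hα.2, hβ.2]
    calc r * (δ * -inner ℝ w n) = δ * (r * -inner ℝ w n) := by ring
      _ ≤ δ * (‖w‖ * (3 * δ * ‖w‖)) := mul_le_mul_of_nonneg_left h5 (by linarith)
      _ = _ := by ring

/-- Going down from a boundary point, the convex hull of the digitization is reached within
distance `4 * h`: the inner tangent disc contains discs of radius proportional to the depth. -/
theorem add_smul_down_mem (hS : HasRollingDiscs S r R) (hh : 0 < h) (hhr : 16 * h ≤ r)
    {M v d : Plane} (hv : v ≠ 0) (hM : M ∈ frontier S) (hn : IsNormal S M (rightNormal v))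
    (hd : IsDown v d) : M + (4 * h) • d ∈ convexHull ℝ (gaussDig h S) := by
  apply mem_convexHull_gaussDig hh
  refine (Metric.closedBall_subset_closedBall' ?_).trans (hS.inner_disc M hM _ hn)
  rw [dist_eq_norm, show M + (4 * h) • d - (M - r • rightNormal v) =
    (4 * h) • d + r • rightNormal v by module]
  have hd1 := hd.norm_eq_one
  have hvpos : 0 < ‖v‖ := norm_pos_iff.2 hv
  -- the angle between `d` and the inward normal is at most `π / 4`, and `7 / 10 ≤ cos (π / 4)`
  have hmax : 7 / 10 ≤ det2 v d / ‖v‖ := by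
    rw [hd.2, le_div_iff₀ hvpos]
    refine le_of_sq_le_sq ?_ (le_max_of_le_left (abs_nonneg _))
    rw [mul_pow, plane_norm_sq]
    rcases max_cases |v 0| |v 1| with ⟨h1, h2⟩ | ⟨h1, h2⟩ <;> rw [h1, sq_abs]
    · have := sq_le_sq.2 h2
      nlinarith
    · have := sq_le_sq.2 h2.le
      nlinarith
  have hb : ‖(4 * h) • d + r • rightNormal v‖ ≤ r - 2 * h := by
    refine le_of_sq_le_sq ?_ (by linarith)
    rw [norm_add_sq_real, inner_smul_right, inner_smul_left, norm_smul, norm_smul, hd1, hn.1,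
      inner_rightNormal, conj_trivial, Real.norm_eq_abs, Real.norm_eq_abs, mul_one, mul_one,
      sq_abs, sq_abs, neg_div]
    have h1 : h * r * (7 / 10) ≤ h * r * (det2 v d / ‖v‖) :=
      mul_le_mul_of_nonneg_left hmax (mul_pos hh hS.r_pos).le
    nlinarith [mul_le_mul_of_nonneg_left hhr hh.le]
  linarith

/-- The error made with an edge is at most proportional to its length. -/
theorem directionError_le (hS : HasRollingDiscs S r R) {c : Plane} {D : ℝ}
    (hc : Metric.closedBall c r ⊆ S) (hD : S ⊆ Metric.closedBall c D) (hh : 0 < h)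
    (hhr : 16 * h ≤ r) (he : e ∈ edges h (gaussDig h S))
    (hsmall : 18 * D * ‖edgeVec h e‖ < r ^ 2) {M v d : Plane} (hv : v ≠ 0)
    (hM : M ∈ frontier S) (hn : IsNormal S M (rightNormal v)) (hd : IsDown v d)
    (hb : LiesBelow h (gaussDig h S) e M d) :
    directionError h e v ≤ 15 / r * ‖edgeVec h e‖ := by
  have hr := hS.r_pos
  obtain ⟨s, hs0, hX, hfirst⟩ := hb
  have hs : s ≤ 4 * h := by
    by_contra hcon
    push Not at hcon
    exact hfirst (4 * h) (by positivity) hcon (hS.add_smul_down_mem hh hhr hv hM hn hd)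
  have hd1 := hd.norm_eq_one
  have hvpos : 0 < ‖v‖ := norm_pos_iff.2 hv
  obtain ⟨A, hAf, m, hm, hA1, hA2⟩ := hS.exists_frontier_near_edge hh he
  have hle := le_norm_edgeVec he
  obtain ⟨θ, hθ, hXe⟩ := mem_segment_gridPt hX
  set E := edgeVec h e with hE
  set n := rightNormal v with hnn
  set X := M + s • d with hXdef
  have hMX : ‖M - X‖ ≤ 4 * h := by
    rw [hXdef, sub_add_cancel_left, norm_neg, norm_smul, hd1, Real.norm_eq_abs, abs_of_nonneg hs0]
    linarith
  have hXP : ‖X - gridPt h e.1‖ ≤ ‖E‖ := by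
    rw [hXe, add_sub_cancel_left, norm_smul, Real.norm_eq_abs, abs_of_nonneg hθ.1]
    exact mul_le_of_le_one_left (norm_nonneg _) hθ.2
  have hMA : ‖M - A‖ ≤ 6 * ‖E‖ := by
    calc ‖M - A‖ = ‖(M - X) + (X - gridPt h e.1) + (gridPt h e.1 - A)‖ := by congr 1; abel
      _ ≤ ‖M - X‖ + ‖X - gridPt h e.1‖ + ‖gridPt h e.1 - A‖ := norm_add₃_le
      _ ≤ 6 * ‖E‖ := by linarith
  have hinner : r * |inner ℝ E n| ≤ 9 * ‖E‖ ^ 2 := by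
    have h1 := hS.norm_normal_sub_le hM hAf hn hm
    have h2 : |inner ℝ E n| ≤ |inner ℝ E m| + ‖E‖ * ‖n - m‖ := by
      have h3 : inner ℝ E n = inner ℝ E m + inner ℝ E (n - m) := by rw [inner_sub_right]; ring
      rw [h3]
      exact (abs_add_le _ _).trans (add_le_add le_rfl (abs_real_inner_le_norm _ _))
    calc r * |inner ℝ E n| ≤ r * (|inner ℝ E m| + ‖E‖ * ‖n - m‖) :=
          mul_le_mul_of_nonneg_left h2 hr.le
      _ = r * |inner ℝ E m| + ‖E‖ * (r * ‖n - m‖) := by ring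
      _ ≤ 3 * ‖E‖ ^ 2 + ‖E‖ * (6 * ‖E‖) :=
          add_le_add hA2 (mul_le_mul_of_nonneg_left (h1.trans hMA) (norm_nonneg _))
      _ = _ := by ring
  have hdet : r * |det2 E v| ≤ 9 * ‖E‖ ^ 2 * ‖v‖ := by
    have h1 : det2 E v = inner ℝ E n * ‖v‖ := by
      rw [hnn, inner_rightNormal, div_mul_cancel₀ _ hvpos.ne', det2, det2]; ring
    rw [h1, abs_mul, abs_of_pos hvpos, ← mul_assoc]
    exact mul_le_mul_of_nonneg_right hinner hvpos.le
  have hEpos : 0 < ‖E‖ := hh.trans_le hle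
  -- both directions leave the disc around `c` on their left
  have horient : 0 ≤ inner ℝ E v := by
    by_contra hneg
    push Not at hneg
    have hcK : c ∈ convexHull ℝ (gaussDig h S) :=
      closedBall_subset_convexHull_gaussDig hh hc
        (Metric.mem_closedBall_self (by linarith))
    have h1 : 0 ≤ det2 E (c - X) := by
      have := det2_edgeVec_nonneg he hcK
      rw [hXe]
      rw [← hE] at this
      have h2 : det2 E (c - (gridPt h e.1 + θ • E)) = det2 E (c - gridPt h e.1) := by
        simp [det2]; ring
      rw [h2]; exact this
    have h2 : r / 2 * ‖v‖ ≤ det2 v (c - X) := by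
      have h3 := hn.inner_le_of_closedBall hr.le hc
      have h4 : inner ℝ (M - X) n ≤ 4 * h := by
        have := real_inner_le_norm (M - X) n
        rw [hn.1, mul_one] at this
        linarith
      have h5 : inner ℝ (c - X) n ≤ -(r / 2) := by
        rw [show c - X = (c - M) + (M - X) by abel, inner_add_left]
        linarith
      rw [hnn, inner_rightNormal, div_le_iff₀ hvpos] at h5
      linarith
    have h3 : ‖c - X‖ ≤ D := by
      have hXS : X ∈ S := by
        refine hS.convex.segment_subset (fst_mem_of_mem_edges he).1 (snd_mem_of_mem_edges he).1 hX
      have := hD hXS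
      rwa [Metric.mem_closedBall, dist_comm, dist_eq_norm] at this
    have h4 : ‖E‖ ^ 2 * det2 v (c - X)
        = inner ℝ E v * det2 E (c - X) - det2 E v * inner ℝ E (c - X) := by
      rw [plane_norm_sq, plane_inner, plane_inner, det2, det2, det2]; ring
    have h5 : inner ℝ E v * det2 E (c - X) ≤ 0 := mul_nonpos_of_nonpos_of_nonneg hneg.le h1
    have h6 : -(det2 E v * inner ℝ E (c - X)) ≤ |det2 E v| * (‖E‖ * D) := by
      refine (neg_le_abs _).trans ?_
      rw [abs_mul]
      refine mul_le_mul_of_nonneg_left ?_ (abs_nonneg _)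
      exact (abs_real_inner_le_norm _ _).trans (mul_le_mul_of_nonneg_left h3 hEpos.le)
    have hD0 : 0 ≤ D := (norm_nonneg _).trans h3
    have h7 : r * (‖E‖ ^ 2 * (r / 2 * ‖v‖)) ≤ 9 * ‖E‖ ^ 2 * ‖v‖ * (‖E‖ * D) := by
      calc r * (‖E‖ ^ 2 * (r / 2 * ‖v‖)) ≤ r * (‖E‖ ^ 2 * det2 v (c - X)) := by gcongr
        _ ≤ r * (|det2 E v| * (‖E‖ * D)) := by
            apply mul_le_mul_of_nonneg_left _ hr.le; linarith
        _ = (r * |det2 E v|) * (‖E‖ * D) := by ring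
        _ ≤ _ := mul_le_mul_of_nonneg_right hdet (by positivity)
    have h8 : (‖E‖ ^ 2 * ‖v‖) * r ^ 2 ≤ (‖E‖ ^ 2 * ‖v‖) * (18 * D * ‖E‖) := by linarith
    have := le_of_mul_le_mul_left h8 (by positivity)
    linarith
  rw [directionError, ← hE]
  set φ := InnerProductGeometry.angle E v with hφ
  have hφ2 : φ ≤ π / 2 := by
    rw [hφ, InnerProductGeometry.angle, Real.arccos_le_pi_div_two]
    positivity
  have hφ0 : 0 ≤ φ := InnerProductGeometry.angle_nonneg _ _
  have hsin : sin φ * (‖E‖ * ‖v‖) = |det2 E v| := by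
    rw [hφ, InnerProductGeometry.sin_angle_mul_norm_mul_norm, real_inner_self_eq_norm_sq,
      real_inner_self_eq_norm_sq, ← inner_sq_add_det2_sq, ← Real.sqrt_sq_eq_abs]
    congr 1
    ring
  have hj := Real.mul_le_sin hφ0 hφ2
  have hsin' : r * sin φ ≤ 9 * ‖E‖ := by
    have h1 : (r * sin φ) * (‖E‖ * ‖v‖) ≤ (9 * ‖E‖) * (‖E‖ * ‖v‖) := by
      rw [mul_assoc, hsin]; linarith
    exact le_of_mul_le_mul_right h1 (by positivity)
  have hφs : φ ≤ π / 2 * sin φ := by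
    calc φ = π / 2 * (2 / π * φ) := by field_simp
      _ ≤ _ := mul_le_mul_of_nonneg_left hj (by positivity)
  have hs0' : 0 ≤ sin φ := Real.sin_nonneg_of_nonneg_of_le_pi hφ0 (by linarith [Real.pi_pos])
  rw [div_mul_eq_mul_div, le_div_iff₀ hr]
  calc φ * r ≤ π / 2 * sin φ * r := mul_le_mul_of_nonneg_right hφs hr.le
    _ = π / 2 * (r * sin φ) := by ring
    _ ≤ π / 2 * (9 * ‖E‖) := mul_le_mul_of_nonneg_left hsin' (by positivity)
    _ ≤ 15 * ‖E‖ := by nlinarith [Real.pi_lt_d2]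

end HasRollingDiscs

end

noncomputable section

/-! ### Digital parameters and the length of an edge -/

variable {h : ℝ} {S : Set Plane} {e : (ℤ × ℤ) × (ℤ × ℤ)}

theorem edgeQ_eq (he : e ∈ edges h (gaussDig h S)) :
    edgeQ e = max (edgePrim e).1.natAbs (edgePrim e).2.natAbs := by
  have h0 := edgeDelta_zsmul_edgePrim e
  have h1 : e.2.1 - e.1.1 = edgeDelta e * (edgePrim e).1 := by
    have := congrArg Prod.fst h0
    simpa using this.symm
  have h2 : e.2.2 - e.1.2 = edgeDelta e * (edgePrim e).2 := by
    have := congrArg Prod.snd h0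
    simpa using this.symm
  rw [edgeQ, h1, h2, Int.natAbs_mul, Int.natAbs_mul, Int.natAbs_natCast, Nat.mul_max_mul_left,
    Nat.mul_div_cancel_left _ (edgeDelta_pos he)]

theorem edgeQ_pos (he : e ∈ edges h (gaussDig h S)) : 0 < edgeQ e := by
  rw [edgeQ_eq he, Nat.pos_iff_ne_zero]
  intro h0
  refine edgePrim_ne_zero he (Prod.ext ?_ ?_)
  · exact Int.natAbs_eq_zero.1 (by omega)
  · exact Int.natAbs_eq_zero.1 (by omega)

theorem mul_edgeQ_le_norm (hh : 0 < h) (he : e ∈ edges h (gaussDig h S)) :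
    h * edgeQ e ≤ ‖gridPt h (edgePrim e)‖ := by
  have h0 := abs_coord_le_norm (gridPt h (edgePrim e)) 0
  have h1 := abs_coord_le_norm (gridPt h (edgePrim e)) 1
  rw [gridPt_zero_coord, abs_mul, abs_of_pos hh] at h0
  rw [gridPt_one_coord, abs_mul, abs_of_pos hh] at h1
  rw [edgeQ_eq he, Nat.cast_max, mul_max_of_nonneg _ _ hh.le, Nat.cast_natAbs, Nat.cast_natAbs,
    Int.cast_abs, Int.cast_abs]
  exact max_le h0 h1

theorem norm_gridPt_edgePrim_le (hh : 0 < h) (he : e ∈ edges h (gaussDig h S)) :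
    ‖gridPt h (edgePrim e)‖ ≤ 2 * (h * edgeQ e) := by
  refine le_of_sq_le_sq ?_ (by positivity)
  rw [plane_norm_sq, gridPt_zero_coord, gridPt_one_coord]
  have h0 : |((edgePrim e).1 : ℝ)| ≤ edgeQ e := by
    rw [← Int.cast_abs, ← Nat.cast_natAbs, edgeQ_eq he]
    exact_mod_cast le_max_left _ _
  have h1 : |((edgePrim e).2 : ℝ)| ≤ edgeQ e := by
    rw [← Int.cast_abs, ← Nat.cast_natAbs, edgeQ_eq he]
    exact_mod_cast le_max_right _ _
  have h2 := pow_le_pow_left₀ (abs_nonneg _) h0 2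
  have h3 := pow_le_pow_left₀ (abs_nonneg _) h1 2
  rw [sq_abs] at h2 h3
  nlinarith [mul_le_mul_of_nonneg_left h2 (sq_nonneg h), mul_le_mul_of_nonneg_left h3 (sq_nonneg h),
    sq_nonneg (h * edgeQ e)]

theorem norm_edgeVec_eq (h : ℝ) (e : (ℤ × ℤ) × (ℤ × ℤ)) :
    ‖edgeVec h e‖ = edgeDelta e * ‖gridPt h (edgePrim e)‖ := by
  rw [edgeVec_eq_smul, norm_smul, Real.norm_eq_abs, abs_of_nonneg (Nat.cast_nonneg _)]

/-- A grid point on the first grid line parallel to an edge, on the outer side. -/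
theorem exists_det_edgePrim (he : e ∈ edges h (gaussDig h S)) :
    ∃ z : ℤ × ℤ, (edgePrim e).1 * z.2 - (edgePrim e).2 * z.1 = -1 := by
  have hcop : IsCoprime (edgePrim e).1 (edgePrim e).2 := by
    rw [Int.isCoprime_iff_gcd_eq_one]
    exact Int.gcd_ediv_gcd_ediv_gcd (edgeDelta_pos he)
  obtain ⟨u, v, huv⟩ := hcop
  exact ⟨(v, -u), by simp only; linarith⟩

namespace HasRollingDiscs

variable {r R : ℝ}

/-- An edge made of several patterns is short: the first grid line parallel to the edge on the outer
side has a point above the middle pattern, at distance at most `h / q`, which is not in the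
shape. -/
theorem edgeDelta_sq_mul_le (hS : HasRollingDiscs S r R) (hh : 0 < h)
    (he : e ∈ edges h (gaussDig h S)) (hδ : 2 ≤ edgeDelta e) :
    (edgeDelta e : ℝ) ^ 2 * (edgeQ e) ^ 3 * h ≤ 11 * R := by
  obtain ⟨z, hz⟩ := exists_det_edgePrim he
  have hq : (0 : ℝ) < edgeQ e := by exact_mod_cast edgeQ_pos he
  have hwq := mul_edgeQ_le_norm hh he
  have hE := edgeVec_eq_smul h e
  have hEn := norm_edgeVec_eq h e
  set w := gridPt h (edgePrim e) with hw
  set g := gridPt h z with hg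
  have hdet : det2 w g = -h ^ 2 := by
    have hz' : ((edgePrim e).1 : ℝ) * z.2 - (edgePrim e).2 * z.1 = -1 := by exact_mod_cast hz
    rw [hw, hg, det2]
    simp only [gridPt_zero_coord, gridPt_one_coord]
    linear_combination h ^ 2 * hz'
  have hwpos : 0 < ‖w‖ := lt_of_lt_of_le (by positivity) hwq
  set δ : ℝ := (edgeDelta e : ℝ) with hδe
  have hδ2 : (2 : ℝ) ≤ δ := by rw [hδe]; exact_mod_cast hδ
  set σ : ℝ := inner ℝ g w / ‖w‖ ^ 2 with hσ
  set m : ℤ := ⌈(δ - 1) / 2 - σ⌉ with hm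
  set s : ℝ := m + σ with hs
  have hs1 : (δ - 1) / 2 ≤ s := by linarith [Int.le_ceil ((δ - 1) / 2 - σ)]
  have hs2 : s ≤ (δ + 1) / 2 := by linarith [Int.ceil_lt_add_one ((δ - 1) / 2 - σ)]
  have hQgrid : gridPt h e.1 + g + (m : ℝ) • w = gridPt h (e.1 + z + m • edgePrim e) := by
    rw [gridPt_add, gridPt_add, gridPt_zsmul]
  have hQ : gridPt h e.1 + g + (m : ℝ) • w ∉ S := by
    intro hmem
    have h1 := det2_edgeVec_nonneg he (subset_convexHull ℝ _
      (⟨hmem, hQgrid ▸ mem_range_self _⟩ : _ ∈ gaussDig h S))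
    have h2 : det2 (edgeVec h e) (gridPt h e.1 + g + (m : ℝ) • w - gridPt h e.1)
        = δ * det2 w g := by
      rw [hE]; simp [det2]; ring
    rw [h2, hdet] at h1
    have : 0 < δ * h ^ 2 := by positivity
    linarith
  have hZ : (1 - s / δ) • gridPt h e.1 + (s / δ) • gridPt h e.2 = gridPt h e.1 + s • w := by
    have h1 : gridPt h e.2 = gridPt h e.1 + δ • w := by rw [← hE, edgeVec]; abel
    rw [h1, smul_add, smul_smul, div_mul_cancel₀ _ (by positivity)]
    module
  have hdist : ‖gridPt h e.1 + g + (m : ℝ) • w -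
      ((1 - s / δ) • gridPt h e.1 + (s / δ) • gridPt h e.2)‖ ≤ h ^ 2 / ‖w‖ := by
    rw [hZ, show gridPt h e.1 + g + (m : ℝ) • w - (gridPt h e.1 + s • w) = g - σ • w by
      rw [hs]; module, le_div_iff₀ hwpos]
    refine le_of_sq_le_sq ?_ (by positivity)
    have h1 := inner_sq_add_det2_sq w g
    rw [hdet, real_inner_comm] at h1
    rw [mul_pow, norm_sub_sq_real, inner_smul_right, norm_smul, Real.norm_eq_abs, mul_pow, sq_abs]
    have h2 : inner ℝ g w = σ * ‖w‖ ^ 2 := by rw [hσ]; field_simp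
    rw [h2] at h1 ⊢
    linarith
  have hs0 : 0 ≤ s / δ := div_nonneg (by linarith) (by linarith)
  have hs0' : 0 ≤ 1 - s / δ := by
    rw [sub_nonneg, div_le_one (by linarith)]; linarith
  have key := hS.chord_sq_le (fst_mem_of_mem_edges he).1 (snd_mem_of_mem_edges he).1
    hs0' hs0 (by ring) hQ hdist
  rw [← edgeVec, hEn] at key
  have h3 : 3 / 16 * (δ * ‖w‖) ^ 2 ≤ (1 - s / δ) * (s / δ) * (δ * ‖w‖) ^ 2 := by
    have h4 : (1 - s / δ) * (s / δ) * (δ * ‖w‖) ^ 2 = (δ - s) * s * ‖w‖ ^ 2 := by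
      field_simp
    rw [h4]
    have h5 : 3 / 16 * δ ^ 2 ≤ (δ - s) * s := by nlinarith
    nlinarith [mul_le_mul_of_nonneg_right h5 (sq_nonneg ‖w‖)]
  have h6 : 3 / 16 * (δ * ‖w‖) ^ 2 ≤ 2 * R * (h ^ 2 / ‖w‖) := h3.trans key
  rw [mul_div_assoc', le_div_iff₀ hwpos] at h6
  have h7 : (h * (edgeQ e : ℝ)) ^ 3 ≤ ‖w‖ ^ 3 := pow_le_pow_left₀ (by positivity) hwq 3
  have h8 : δ ^ 2 * (h * (edgeQ e : ℝ)) ^ 3 ≤ δ ^ 2 * ‖w‖ ^ 3 :=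
    mul_le_mul_of_nonneg_left h7 (by positivity)
  have hR := hS.R_pos
  have h9 : (δ ^ 2 * (edgeQ e : ℝ) ^ 3 * h) * h ^ 2 ≤ (11 * R) * h ^ 2 := by
    have : 0 ≤ R * h ^ 2 := by positivity
    linarith
  exact le_of_mul_le_mul_right h9 (by positivity)

/-- With `x = h ^ (1 / 3)`: an edge with `q ≤ 1 / x` satisfies `δ * q ≤ δ / x`, and on the other
edges `δ` is bounded. -/
theorem edgeDelta_mul_edgeQ_le (hS : HasRollingDiscs S r R) (hh : 0 < h)
    (he : e ∈ edges h (gaussDig h S)) {x : ℝ} (hx : 0 < x) (hxh : x ^ 3 = h) :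
    (edgeDelta e : ℝ) * edgeQ e ≤ (11 * R + 1) * edgeQ e + edgeDelta e / x := by
  have hq : (0 : ℝ) < edgeQ e := by exact_mod_cast edgeQ_pos he
  have hδ0 : (1 : ℝ) ≤ edgeDelta e := by exact_mod_cast edgeDelta_pos he
  have hR := hS.R_pos
  rcases le_or_gt ((edgeQ e : ℝ) * x) 1 with h1 | h1
  · have h2 : (edgeQ e : ℝ) ≤ 1 / x := by rwa [le_div_iff₀ hx]
    have h3 := mul_le_mul_of_nonneg_left h2 (zero_le_one.trans hδ0)
    rw [mul_one_div] at h3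
    have : 0 ≤ (11 * R + 1) * (edgeQ e : ℝ) := by positivity
    linarith
  · have hδ : (edgeDelta e : ℝ) ≤ 11 * R + 1 := by
      rcases Nat.lt_or_ge (edgeDelta e) 2 with h2 | h2
      · have : (edgeDelta e : ℝ) ≤ 1 := by exact_mod_cast Nat.lt_succ_iff.1 h2
        linarith
      · have h3 := hS.edgeDelta_sq_mul_le hh he h2
        rw [← hxh, mul_assoc, ← mul_pow] at h3
        have h4 : 1 ≤ ((edgeQ e : ℝ) * x) ^ 3 := one_le_pow₀ h1.le
        nlinarith [sq_nonneg (edgeDelta e : ℝ)]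
    have h2 := mul_le_mul_of_nonneg_right hδ hq.le
    have : 0 ≤ (edgeDelta e : ℝ) / x := by positivity
    linarith

/-- The error made with an edge is at most proportional to its length, uniformly in the edge, once
the grid is fine enough. -/
theorem exists_directionError_le (hS : HasRollingDiscs S r R) (hC : S ∈ ConvexC3Shapes) :
    ∃ h₀ > 0, ∀ h, 0 < h → h < h₀ → ∀ e ∈ edges h (gaussDig h S), ∀ M v d, IsTangent S M v →
      IsDown v d → LiesBelow h (gaussDig h S) e M d →
        directionError h e v ≤ 15 / r * ‖edgeVec h e‖ := by
  obtain ⟨c, D, hD0, hc, hD⟩ := hS.exists_disc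
  have hr := hS.r_pos
  have hR := hS.R_pos
  refine ⟨min (r / 16) (r ^ 4 / ((18 * D) ^ 2 * (24 * R))), by positivity,
    fun h hh hh0 e he M v d hv hd hb => ?_⟩
  have h1 : h < r / 16 := hh0.trans_le (min_le_left _ _)
  have h2 : h < r ^ 4 / ((18 * D) ^ 2 * (24 * R)) := hh0.trans_le (min_le_right _ _)
  rw [lt_div_iff₀ (by positivity)] at h2
  obtain ⟨hv0, hM, hn⟩ := hv.isNormal hC
  refine hS.directionError_le hc hD hh (by linarith) he ?_ hv0 hM hn hd hb
  refine lt_of_pow_lt_pow_left₀ 2 (by positivity) ?_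
  have h3 := mul_le_mul_of_nonneg_left (hS.norm_edgeVec_sq_le hh he) (sq_nonneg (18 * D))
  calc (18 * D * ‖edgeVec h e‖) ^ 2 = (18 * D) ^ 2 * ‖edgeVec h e‖ ^ 2 := by ring
    _ ≤ (18 * D) ^ 2 * (24 * R * h) := h3
    _ = h * ((18 * D) ^ 2 * (24 * R)) := by ring
    _ < (r ^ 2) ^ 2 := by rw [← pow_mul]; exact h2

end HasRollingDiscs

/-! ### Means over the edges -/

theorem finite_edges (hh : 0 < h) (hS : Bornology.IsBounded S) :
    (edges h (gaussDig h S)).Finite := by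
  have hfin : (gridPt h ⁻¹' gaussDig h S).Finite :=
    (finite_gaussDig hh hS).preimage (gridPt_injective hh).injOn
  exact (hfin.prod hfin).subset fun e he => ⟨fst_mem_of_mem_edges he, snd_mem_of_mem_edges he⟩

theorem edgeMean_eq_sum (hfin : (edges h (gaussDig h S)).Finite)
    (f : (ℤ × ℤ) × (ℤ × ℤ) → ℝ) :
    edgeMean h S f = (∑ e ∈ hfin.toFinset, f e) / (edges h (gaussDig h S)).ncard := by
  rw [edgeMean, finsum_mem_eq_finite_toFinset_sum _ hfin]

theorem worstError_nonneg (h : ℝ) (S : Set Plane) (e : (ℤ × ℤ) × (ℤ × ℤ)) :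
    0 ≤ worstError h S e := by
  apply Real.sSup_nonneg
  rintro _ ⟨M, v, d, -, -, -, rfl⟩
  exact InnerProductGeometry.angle_nonneg _ _

theorem isBigO_edgeMean_worstError (hC : S ∈ ConvexC3Shapes) (hlaw : AsymptoticEdgeLaw S) :
    (fun h : ℝ => edgeMean h S (worstError h S)) =O[𝓝[>] 0] (fun h : ℝ => h ^ (2 / 3 : ℝ)) := by
  obtain ⟨r, R, hS⟩ := exists_hasRollingDiscs hC
  have hr := hS.r_pos
  have hR := hS.R_pos
  obtain ⟨h₀, hh₀, herr⟩ := hS.exists_directionError_le hC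
  obtain ⟨a, ha⟩ := hlaw.q_theta.1.bound
  obtain ⟨b, hb⟩ := hlaw.delta_bounded.bound
  refine IsBigO.of_bound (30 / r * ((11 * R + 1) * a + b)) ?_
  filter_upwards [ha, hb, self_mem_nhdsWithin, Ioo_mem_nhdsGT hh₀] with h ha hb hpos hlt
  have hh : 0 < h := hpos
  have hfin := finite_edges hh hS.isCompact.isBounded
  set x : ℝ := h ^ (1 / 3 : ℝ) with hx
  have hx0 : 0 < x := by positivity
  have hx3 : x ^ 3 = h := by
    rw [hx, ← Real.rpow_natCast, ← Real.rpow_mul hh.le]; norm_num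
  have hx2 : h ^ (2 / 3 : ℝ) = x ^ 2 := by
    rw [hx, ← Real.rpow_natCast, ← Real.rpow_mul hh.le]; norm_num
  have hworst : ∀ e ∈ edges h (gaussDig h S), worstError h S e ≤
      30 / r * h * ((11 * R + 1) * edgeQ e + edgeDelta e / x) := by
    intro e he
    have hle : 15 / r * ‖edgeVec h e‖ ≤
        30 / r * h * ((11 * R + 1) * edgeQ e + edgeDelta e / x) := by
      calc 15 / r * ‖edgeVec h e‖ ≤ 15 / r * (edgeDelta e * (2 * (h * edgeQ e))) := by
            rw [norm_edgeVec_eq]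
            gcongr
            exact norm_gridPt_edgePrim_le hh he
        _ = 30 / r * h * (edgeDelta e * edgeQ e) := by ring
        _ ≤ _ := mul_le_mul_of_nonneg_left (hS.edgeDelta_mul_edgeQ_le hh he hx0 hx3)
            (by positivity)
    apply Real.sSup_le
    · rintro _ ⟨M, v, d, hv, hd, hb, rfl⟩
      exact (herr h hh hlt.2 e he M v d hv hd hb).trans hle
    · exact le_trans (by positivity) hle
  have hmean : edgeMean h S (worstError h S) ≤ 30 / r * h *
      ((11 * R + 1) * edgeMean h S (fun e => (edgeQ e : ℝ))
        + edgeMean h S (fun e => (edgeDelta e : ℝ)) / x) := by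
    simp only [edgeMean_eq_sum hfin]
    calc _ ≤ (∑ e ∈ hfin.toFinset, 30 / r * h * ((11 * R + 1) * edgeQ e + edgeDelta e / x)) /
          ((edges h (gaussDig h S)).ncard : ℝ) := by
            gcongr with e he
            exact hworst e (hfin.mem_toFinset.1 he)
      _ = _ := by
            rw [← Finset.mul_sum, Finset.sum_add_distrib, ← Finset.mul_sum, ← Finset.sum_div]
            ring
  have hmean0 : 0 ≤ edgeMean h S (worstError h S) := by
    rw [edgeMean_eq_sum hfin]
    exact div_nonneg (Finset.sum_nonneg fun e _ => worstError_nonneg h S e) (Nat.cast_nonneg _)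
  have ha' := (le_abs_self _).trans ha
  have hb' := (le_abs_self _).trans hb
  rw [norm_one, mul_one] at hb'
  rw [Real.norm_eq_abs, abs_of_pos (by positivity)] at ha'
  rw [Real.norm_eq_abs, Real.norm_eq_abs, abs_of_nonneg hmean0, hx2, abs_of_pos (by positivity)]
  refine hmean.trans ?_
  calc _ ≤ 30 / r * h * ((11 * R + 1) * (a * (1 / x)) + b / x) := by gcongr
    _ = 30 / r * ((11 * R + 1) * a + b) * x ^ 2 := by
        rw [← hx3]; field_simp

end

noncomputable section

/-! ### The edges cover the boundary of the convex hull -/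

/-- The vector `n` turned by a right angle counterclockwise; for an outward normal `n`, it is the
direction in which the boundary is run. -/
def leftTurn (n : Plane) : Plane := !₂[-n 1, n 0]

theorem inner_leftTurn (w n : Plane) : inner ℝ w (leftTurn n) = det2 n w := by
  rw [plane_inner, det2, leftTurn]; simp; ring

theorem decomp_of_norm_one {n : Plane} (hn : ‖n‖ = 1) (w : Plane) :
    w = inner ℝ w n • n + inner ℝ w (leftTurn n) • leftTurn n := by
  have h1 := plane_norm_sq n
  rw [hn] at h1
  rw [inner_leftTurn, plane_inner, det2]
  apply plane_ext
  · simp [leftTurn]; linear_combination (w 0) * h1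
  · simp [leftTurn]; linear_combination (w 1) * h1

theorem isNormal_convexHull {Γ : Set Plane} {M n : Plane} (hn : ‖n‖ = 1)
    (hle : ∀ P ∈ Γ, inner ℝ (P - M) n ≤ 0) : IsNormal (convexHull ℝ Γ) M n := by
  refine ⟨hn, fun Y hY => ?_⟩
  have hconv : Convex ℝ {Y : Plane | inner ℝ (Y - M) n ≤ 0} := by
    intro A hA B hB a b ha hb hab
    simp only [mem_ofPred_eq] at *
    have : inner ℝ (a • A + b • B - M) n = a * inner ℝ (A - M) n + b * inner ℝ (B - M) n := by
      obtain rfl : a = 1 - b := by linarith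
      rw [show (1 - b) • A + b • B - M = (1 - b) • (A - M) + b • (B - M) by module,
        inner_add_left, inner_smul_left, inner_smul_left]
      simp
    rw [this]
    have h1 := mul_nonpos_of_nonneg_of_nonpos ha hA
    have h2 := mul_nonpos_of_nonneg_of_nonpos hb hB
    linarith
  exact convexHull_min hle hconv hY

variable {h : ℝ} {S : Set Plane}

/-- The point of a face of a convex set that comes first in a direction `t`, which together with the
normal determines a vector, is extreme. -/
theorem mem_extremePoints_of_face {K : Set Plane} {X n t : Plane} (hn : IsNormal K X n)
    (ht : ∀ w : Plane, inner ℝ w n = 0 → inner ℝ w t = 0 → w = 0) {A : Plane} (hA : A ∈ K)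
    (hA0 : inner ℝ (A - X) n = 0)
    (hmin : ∀ Z ∈ K, inner ℝ (Z - X) n = 0 → inner ℝ A t ≤ inner ℝ Z t) :
    A ∈ K.extremePoints ℝ := by
  rw [mem_extremePoints]
  refine ⟨hA, ?_⟩
  rintro Z₁ h1 Z₂ h2 ⟨a, b, ha, hb, hab, rfl⟩
  obtain rfl : a = 1 - b := by linarith
  have e1 := hn.2 _ h1
  have e2 := hn.2 _ h2
  rw [show (1 - b) • Z₁ + b • Z₂ - X = (1 - b) • (Z₁ - X) + b • (Z₂ - X) by module,
    inner_add_left, inner_smul_left, inner_smul_left] at hA0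
  simp only [conj_trivial] at hA0
  have f1 : inner ℝ (Z₁ - X) n = 0 := by
    have := mul_nonpos_of_nonneg_of_nonpos hb.le e2
    have := mul_nonpos_of_nonneg_of_nonpos ha.le e1
    have : (1 - b) * inner ℝ (Z₁ - X) n = 0 := by linarith
    exact (mul_eq_zero.1 this).resolve_left ha.ne'
  have f2 : inner ℝ (Z₂ - X) n = 0 := by
    rw [f1, mul_zero, zero_add] at hA0
    exact (mul_eq_zero.1 hA0).resolve_left hb.ne'
  have g1 := hmin _ h1 f1
  have g2 := hmin _ h2 f2
  rw [inner_add_left, inner_smul_left, inner_smul_left] at g1 g2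
  simp only [conj_trivial] at g1 g2
  have g3 : inner ℝ Z₁ t = inner ℝ Z₂ t := by
    apply le_antisymm
    · have : (1 - b) * inner ℝ Z₁ t ≤ (1 - b) * inner ℝ Z₂ t := by linarith
      exact le_of_mul_le_mul_left this ha
    · have : b * inner ℝ Z₂ t ≤ b * inner ℝ Z₁ t := by linarith
      exact le_of_mul_le_mul_left this hb
  have hZ : Z₁ = Z₂ := by
    rw [← sub_eq_zero]
    apply ht
    · rw [show Z₁ - Z₂ = (Z₁ - X) - (Z₂ - X) by abel, inner_sub_left, f1, f2, sub_zero]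
    · rw [inner_sub_left, g3, sub_self]
  subst hZ
  constructor <;> module

/-- A supporting line of the convex hull with two points carries an edge. -/
theorem exists_edge_of_face (hcomp : IsCompact (convexHull ℝ (gaussDig h S))) {X Y n : Plane}
    (hX : X ∈ convexHull ℝ (gaussDig h S)) (hY : Y ∈ convexHull ℝ (gaussDig h S)) (hXY : Y ≠ X)
    (hn : IsNormal (convexHull ℝ (gaussDig h S)) X n) (hY0 : inner ℝ (Y - X) n = 0) :
    ∃ e ∈ edges h (gaussDig h S), X ∈ segment ℝ (gridPt h e.1) (gridPt h e.2) := by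
  set K := convexHull ℝ (gaussDig h S) with hK
  set t := leftTurn n with ht
  have hdec := decomp_of_norm_one hn.1
  have hdet : ∀ w : Plane, inner ℝ w n = 0 → w = inner ℝ w t • t := by
    intro w hw
    have := hdec w
    rwa [hw, zero_smul, zero_add] at this
  have hface : IsCompact (K ∩ {Z | inner ℝ (Z - X) n = 0}) :=
    hcomp.inter_right (isClosed_eq (by fun_prop) continuous_const)
  have hcont : ContinuousOn (fun Z : Plane => inner ℝ Z t) (K ∩ {Z | inner ℝ (Z - X) n = 0}) :=
    Continuous.continuousOn (by fun_prop)
  have hXF : X ∈ K ∩ {Z | inner ℝ (Z - X) n = 0} := ⟨hX, by simp⟩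
  have hYF : Y ∈ K ∩ {Z | inner ℝ (Z - X) n = 0} := ⟨hY, hY0⟩
  obtain ⟨A, hA, hAmin⟩ := hface.exists_isMinOn ⟨X, hXF⟩ hcont
  obtain ⟨B, hB, hBmax⟩ := hface.exists_isMaxOn ⟨X, hXF⟩ hcont
  have hzero : ∀ w : Plane, inner ℝ w n = 0 → inner ℝ w t = 0 → w = 0 := by
    intro w h1 h2
    rw [hdet w h1, h2, zero_smul]
  have hAext : A ∈ K.extremePoints ℝ :=
    mem_extremePoints_of_face hn hzero hA.1 hA.2 fun Z hZ hZ0 => hAmin ⟨hZ, hZ0⟩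
  have hBext : B ∈ K.extremePoints ℝ := by
    refine mem_extremePoints_of_face (t := -t) hn ?_ hB.1 hB.2 fun Z hZ hZ0 => ?_
    · intro w h1 h2
      rw [inner_neg_right, neg_eq_zero] at h2
      exact hzero w h1 h2
    · rw [inner_neg_right, inner_neg_right]
      exact neg_le_neg (hBmax ⟨hZ, hZ0⟩)
  obtain ⟨-, k, rfl⟩ := extremePoints_convexHull_subset hAext
  obtain ⟨-, l, rfl⟩ := extremePoints_convexHull_subset hBext
  have hAX : inner ℝ (gridPt h k) t ≤ inner ℝ X t := hAmin hXF
  have hAY : inner ℝ (gridPt h k) t ≤ inner ℝ Y t := hAmin hYF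
  have hXB : inner ℝ X t ≤ inner ℝ (gridPt h l) t := hBmax hXF
  have hYB : inner ℝ Y t ≤ inner ℝ (gridPt h l) t := hBmax hYF
  have hAB : inner ℝ (gridPt h k) t < inner ℝ (gridPt h l) t := by
    refine lt_of_le_of_ne (hAX.trans hXB) fun heq => hXY ?_
    rw [← sub_eq_zero]
    apply hzero _ hY0
    rw [inner_sub_left]
    linarith
  have hAB0 : inner ℝ (gridPt h l - gridPt h k) n = 0 := by
    have h1 := hA.2
    have h2 := hB.2
    simp only [mem_ofPred_eq] at h1 h2
    rw [show gridPt h l - gridPt h k = (gridPt h l - X) - (gridPt h k - X) by abel,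
      inner_sub_left, h1, h2, sub_zero]
  have hXA0 : inner ℝ (X - gridPt h k) n = 0 := by
    have h1 := hA.2
    simp only [mem_ofPred_eq] at h1
    rw [← neg_sub, inner_neg_left, h1, neg_zero]
  have e1 := hdet _ hAB0
  have e2 := hdet _ hXA0
  set ab := inner ℝ (gridPt h l - gridPt h k) t with hab
  set ax := inner ℝ (X - gridPt h k) t with hax
  have habpos : 0 < ab := by rw [hab, inner_sub_left]; linarith
  have hax0 : 0 ≤ ax := by rw [hax, inner_sub_left]; linarith
  have haxb : ax ≤ ab := by rw [hab, hax, inner_sub_left, inner_sub_left]; linarith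
  refine ⟨(k, l), ⟨?_, hAext, hBext, fun P hP => ?_⟩, ?_⟩
  · rintro hkl
    simp only at hkl
    rw [hkl] at hAB
    exact lt_irrefl _ hAB
  · simp only
    rw [e1, det2_smul_left]
    apply mul_nonneg habpos.le
    have h1 := hn.2 P (subset_convexHull ℝ _ hP)
    have h2 := hA.2
    simp only [mem_ofPred_eq] at h2
    have h3 : det2 t (P - gridPt h k) = -inner ℝ (P - gridPt h k) n := by
      rw [plane_inner, det2, ht, leftTurn]; simp; ring
    rw [h3, show P - gridPt h k = (P - X) - (gridPt h k - X) by abel, inner_sub_left, h2]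
    linarith
  · rw [segment_eq_image']
    refine ⟨ax / ab, ⟨div_nonneg hax0 habpos.le, (div_le_one habpos).2 haxb⟩, ?_⟩
    simp only
    rw [e1, smul_smul, div_mul_cancel₀ _ habpos.ne', ← e2]
    abel

/-- Every boundary point of the convex hull is on an edge. If a supporting line touches the hull at
that point only, it is turned around the point until it meets another point of the hull. -/
theorem exists_edge_of_notMem_interior (hfin : (gaussDig h S).Finite)
    (hi : (interior (convexHull ℝ (gaussDig h S))).Nonempty) {X : Plane}
    (hX : X ∈ convexHull ℝ (gaussDig h S)) (hXi : X ∉ interior (convexHull ℝ (gaussDig h S))) :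
    ∃ e ∈ edges h (gaussDig h S), X ∈ segment ℝ (gridPt h e.1) (gridPt h e.2) := by
  have hcomp : IsCompact (convexHull ℝ (gaussDig h S)) := hfin.isCompact_convexHull (𝕜 := ℝ)
  obtain ⟨n, hn⟩ := exists_isNormal (convex_convexHull ℝ _) hi hXi
  by_cases hex : ∃ P ∈ gaussDig h S, P ≠ X ∧ inner ℝ (P - X) n = 0
  · obtain ⟨P, hP, hPX, hP0⟩ := hex
    exact exists_edge_of_face hcomp hX (subset_convexHull ℝ _ hP) hPX hn hP0
  push Not at hex
  have hneg : ∀ P ∈ gaussDig h S \ {X}, 0 < inner ℝ (X - P) n := by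
    rintro P ⟨hP, hPX⟩
    have h1 := hn.2 P (subset_convexHull ℝ _ hP)
    have h2 := hex P hP hPX
    rw [← neg_sub, inner_neg_left]
    have := lt_of_le_of_ne h1 h2
    linarith
  have hne : (gaussDig h S \ {X}).Nonempty := by
    by_contra hemp
    rw [not_nonempty_iff_eq_empty, sdiff_eq_empty] at hemp
    have h1 : convexHull ℝ (gaussDig h S) ⊆ {X} := convexHull_min hemp (convex_singleton X)
    obtain ⟨Z, hZ⟩ := hi
    rw [h1 (interior_subset hZ)] at hZ
    exact hXi hZ
  obtain ⟨P₁, hP₁, hmax⟩ := (hfin.sdiff (t := {X})).exists_maximalFor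
    (fun P => inner ℝ (P - X) (leftTurn n) / inner ℝ (X - P) n) _ hne
  have hP₁X : P₁ - X ≠ 0 := sub_ne_zero.2 hP₁.2
  refine exists_edge_of_face hcomp hX (subset_convexHull ℝ _ hP₁.1) hP₁.2
    (n := rightNormal (P₁ - X)) (isNormal_convexHull (norm_rightNormal hP₁X) fun P hP => ?_) ?_
  · rw [inner_rightNormal]
    refine div_nonpos_of_nonpos_of_nonneg (neg_nonpos.2 ?_) (norm_nonneg _)
    rcases eq_or_ne P X with rfl | hPX
    · simp [det2]
    have hP' : P ∈ gaussDig h S \ {X} := ⟨hP, hPX⟩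
    have hb1 := hneg _ hP₁
    have hb := hneg _ hP'
    have hle : inner ℝ (P - X) (leftTurn n) / inner ℝ (X - P) n
        ≤ inner ℝ (P₁ - X) (leftTurn n) / inner ℝ (X - P₁) n := by
      rcases le_total (inner ℝ (P - X) (leftTurn n) / inner ℝ (X - P) n)
        (inner ℝ (P₁ - X) (leftTurn n) / inner ℝ (X - P₁) n) with h1 | h1
      · exact h1
      · exact hmax hP' h1
    rw [div_le_div_iff₀ hb hb1] at hle
    have hnn := plane_norm_sq n
    rw [hn.1] at hnn
    have key : det2 (P₁ - X) (P - X) = inner ℝ (P₁ - X) (leftTurn n) * inner ℝ (X - P) n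
        - inner ℝ (P - X) (leftTurn n) * inner ℝ (X - P₁) n := by
      rw [inner_leftTurn, inner_leftTurn, plane_inner, plane_inner]
      simp only [det2, PiLp.sub_apply]
      linear_combination ((P₁ 0 - X 0) * (P 1 - X 1) - (P₁ 1 - X 1) * (P 0 - X 0)) * hnn
    rw [key]
    linarith
  · rw [inner_rightNormal, det2]; ring

/-- An edge lies below a boundary point as soon as the ray going down from it meets the convex hull
of the digitization. -/
theorem exists_liesBelow (hS : IsCompact S) (hconv : Convex ℝ S) (hh : 0 < h)
    (hi : (interior (convexHull ℝ (gaussDig h S))).Nonempty) {M d : Plane} (hM : M ∈ frontier S)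
    {a : ℝ} (ha : 0 ≤ a) (hd : M + a • d ∈ convexHull ℝ (gaussDig h S)) :
    ∃ e ∈ edges h (gaussDig h S), LiesBelow h (gaussDig h S) e M d := by
  have hfin := finite_gaussDig hh hS.isBounded
  have hcomp : IsCompact (convexHull ℝ (gaussDig h S)) := hfin.isCompact_convexHull (𝕜 := ℝ)
  have hcont : Continuous fun s : ℝ => M + s • d := by fun_prop
  have hA : IsCompact (Icc 0 a ∩ (fun s : ℝ => M + s • d) ⁻¹' convexHull ℝ (gaussDig h S)) :=
    isCompact_Icc.inter_right (hcomp.isClosed.preimage hcont)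
  obtain ⟨s, ⟨hs, hsK⟩, hmin⟩ := hA.exists_isLeast ⟨a, ⟨ha, le_rfl⟩, hd⟩
  have hfirst : ∀ r : ℝ, 0 ≤ r → r < s → M + r • d ∉ convexHull ℝ (gaussDig h S) :=
    fun r hr0 hrs hrK => not_le.2 hrs (hmin ⟨⟨hr0, hrs.le.trans hs.2⟩, hrK⟩)
  have hXi : M + s • d ∉ interior (convexHull ℝ (gaussDig h S)) := by
    intro hint
    rcases hs.1.eq_or_lt with h0 | h0
    · rw [← h0, zero_smul, add_zero] at hint
      exact hM.2 (interior_mono (convexHull_gaussDig_subset hconv h) hint)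
    · have hev : ∀ᶠ u in 𝓝[<] s, M + u • d ∈ interior (convexHull ℝ (gaussDig h S)) :=
        (hcont.tendsto s).mono_left nhdsWithin_le_nhds
          (isOpen_interior.mem_nhds hint)
      obtain ⟨u, hu, hu2⟩ := (hev.and (Ioo_mem_nhdsLT h0)).exists
      exact hfirst u hu2.1.le hu2.2 (interior_subset hu)
  obtain ⟨e, he, hX⟩ := exists_edge_of_notMem_interior hfin hi hsK hXi
  exact ⟨e, he, s, hs.1, hX, hfirst⟩

/-! ### Connectedness of digitizations -/

/-- Two points are joined by a 4-connected path of the digital set `Γ`. -/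
def FourConnected (h : ℝ) (Γ : Set Plane) : Plane → Plane → Prop :=
  Relation.ReflTransGen fun A B => A ∈ Γ ∧ B ∈ Γ ∧ FourAdj h A B

theorem FourConnected.symm {Γ : Set Plane} {P Q : Plane} (hPQ : FourConnected h Γ P Q) :
    FourConnected h Γ Q P := by
  induction hPQ with
  | refl => exact Relation.ReflTransGen.refl
  | tail _ hAB ih =>
    obtain ⟨hA, hB, k, l, rfl, rfl, hkl⟩ := hAB
    refine Relation.ReflTransGen.head ⟨hB, hA, l, k, rfl, rfl, ?_⟩ ih
    rw [abs_sub_comm l.1, abs_sub_comm l.2]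
    exact hkl

/-- The grid point closest to `x`. -/
def roundPt (h : ℝ) (x : Plane) : ℤ × ℤ := (round (x 0 / h), round (x 1 / h))

theorem exists_step_toward_round (y : ℝ) {k : ℤ} (hk : k ≠ round y) :
    ∃ k' : ℤ, |k - k'| = 1 ∧ (k' - round y).natAbs < (k - round y).natAbs ∧
      |(k' : ℝ) - y| ≤ |(k : ℝ) - y| := by
  have hm := abs_sub_round y
  rw [abs_le] at hm
  rcases lt_or_gt_of_ne hk with hlt | hgt
  · refine ⟨k + 1, by simp, by omega, ?_⟩
    have h1 : (k : ℝ) + 1 ≤ round y := by exact_mod_cast hlt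
    push_cast
    rw [abs_of_nonpos (by linarith : (k : ℝ) - y ≤ 0), abs_le]
    constructor <;> linarith
  · refine ⟨k - 1, by simp, by omega, ?_⟩
    have h1 : (round y : ℝ) + 1 ≤ k := by exact_mod_cast hgt
    push_cast
    rw [abs_of_nonneg (by linarith : 0 ≤ (k : ℝ) - y), abs_le]
    constructor <;> linarith

theorem norm_gridPt_sub_le_of_coord (hh : 0 < h) {x : Plane} {k k' : ℤ × ℤ}
    (h0 : |(k'.1 : ℝ) - x 0 / h| ≤ |(k.1 : ℝ) - x 0 / h|)
    (h1 : |(k'.2 : ℝ) - x 1 / h| ≤ |(k.2 : ℝ) - x 1 / h|) :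
    ‖gridPt h k' - x‖ ≤ ‖gridPt h k - x‖ := by
  refine le_of_sq_le_sq ?_ (norm_nonneg _)
  have key : ∀ k : ℤ × ℤ, ‖gridPt h k - x‖ ^ 2
      = h ^ 2 * (((k.1 : ℝ) - x 0 / h) ^ 2 + ((k.2 : ℝ) - x 1 / h) ^ 2) := by
    intro k
    rw [plane_norm_sq]
    simp only [PiLp.sub_apply, gridPt_zero_coord, gridPt_one_coord]
    field_simp
  rw [key, key]
  have e0 := sq_le_sq.2 h0
  have e1 := sq_le_sq.2 h1
  gcongr

/-- The grid points of a disc contained in `S` are joined to the grid point closest to its center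
by paths along which both coordinates get closer to those of the center. -/
theorem fourConnected_roundPt (hh : 0 < h) {x : Plane} {ρ : ℝ}
    (hx : Metric.closedBall x ρ ⊆ S) (k : ℤ × ℤ) (hk : gridPt h k ∈ Metric.closedBall x ρ) :
    FourConnected h (gaussDig h S) (gridPt h k) (gridPt h (roundPt h x)) := by
  induction hN : (k.1 - round (x 0 / h)).natAbs + (k.2 - round (x 1 / h)).natAbs
    using Nat.strong_induction_on generalizing k with
  | _ N ih =>
  have hstep : ∀ k' : ℤ × ℤ, |k.1 - k'.1| + |k.2 - k'.2| = 1 →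
      (k'.1 - round (x 0 / h)).natAbs + (k'.2 - round (x 1 / h)).natAbs < N →
      |(k'.1 : ℝ) - x 0 / h| ≤ |(k.1 : ℝ) - x 0 / h| →
      |(k'.2 : ℝ) - x 1 / h| ≤ |(k.2 : ℝ) - x 1 / h| →
      FourConnected h (gaussDig h S) (gridPt h k) (gridPt h (roundPt h x)) := by
    intro k' h1 h2 h3 h4
    have hk' : gridPt h k' ∈ Metric.closedBall x ρ := by
      rw [Metric.mem_closedBall, dist_eq_norm] at hk ⊢
      exact (norm_gridPt_sub_le_of_coord hh h3 h4).trans hk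
    exact Relation.ReflTransGen.head
      ⟨⟨hx hk, mem_range_self _⟩, ⟨hx hk', mem_range_self _⟩, k, k', rfl, rfl, h1⟩
      (ih _ h2 k' hk' rfl)
  by_cases h0 : k.1 = round (x 0 / h)
  · by_cases h1 : k.2 = round (x 1 / h)
    · have : k = roundPt h x := Prod.ext h0 h1
      rw [this]
      exact Relation.ReflTransGen.refl
    · obtain ⟨j, hj1, hj2, hj3⟩ := exists_step_toward_round _ h1
      exact hstep (k.1, j) (by simpa using hj1) (by simp only; omega) le_rfl hj3
  · obtain ⟨j, hj1, hj2, hj3⟩ := exists_step_toward_round _ h0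
    exact hstep (j, k.2) (by simpa using hj1) (by simp only; omega) hj3 le_rfl

theorem norm_gridPt_roundPt_sub_le (hh : 0 < h) (x : Plane) :
    ‖gridPt h (roundPt h x) - x‖ ≤ h := by
  refine le_of_sq_le_sq ?_ hh.le
  rw [plane_norm_sq]
  simp only [PiLp.sub_apply, gridPt_zero_coord, gridPt_one_coord, roundPt]
  have key : ∀ y : ℝ, (h * round (y / h) - y) ^ 2 ≤ h ^ 2 / 4 := by
    intro y
    have h1 := abs_sub_round (y / h)
    have h2 : (h * round (y / h) - y) ^ 2 = h ^ 2 * (y / h - round (y / h)) ^ 2 := by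
      field_simp; ring
    have h3 : (y / h - round (y / h)) ^ 2 ≤ (1 / 2) ^ 2 := by
      rw [← sq_abs]; exact pow_le_pow_left₀ (abs_nonneg _) h1 2
    rw [h2]
    nlinarith [mul_le_mul_of_nonneg_left h3 (sq_nonneg h)]
  nlinarith [key (x 0), key (x 1), sq_nonneg h]

/-- The grid points closest to the centers of the discs of radius `ρ` contained in a convex set
are 4-connected: they vary by short steps when the center runs along a segment. -/
theorem fourConnected_roundPt_roundPt (hh : 0 < h) (hS : Convex ℝ S) {ρ : ℝ} (hρ : 2 * h ≤ ρ)
    {x y : Plane} (hx : Metric.closedBall x ρ ⊆ S) (hy : Metric.closedBall y ρ ⊆ S) :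
    FourConnected h (gaussDig h S) (gridPt h (roundPt h x)) (gridPt h (roundPt h y)) := by
  have hconv : Convex ℝ {z : Plane | Metric.closedBall z ρ ⊆ S} := by
    intro z hz w hw a b ha hb hab Y hY
    have h1 : z + (Y - (a • z + b • w)) ∈ S := hz (by
      rwa [Metric.mem_closedBall, dist_eq_norm, add_sub_cancel_left, ← dist_eq_norm])
    have h2 : w + (Y - (a • z + b • w)) ∈ S := hw (by
      rwa [Metric.mem_closedBall, dist_eq_norm, add_sub_cancel_left, ← dist_eq_norm])
    convert hS h1 h2 ha hb hab using 1
    obtain rfl : a = 1 - b := by linarith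
    module
  refine hconv.isPreconnected.induction₂
    (fun x y => FourConnected h (gaussDig h S) (gridPt h (roundPt h x)) (gridPt h (roundPt h y)))
    (fun z hz => ?_) (fun _ _ _ _ _ _ => Relation.ReflTransGen.trans)
    (fun _ _ _ _ => FourConnected.symm) hx hy
  filter_upwards [mem_nhdsWithin_of_mem_nhds (Metric.ball_mem_nhds z hh)] with w hw
  apply FourConnected.symm
  apply fourConnected_roundPt hh hz
  rw [Metric.mem_closedBall]
  have h1 := norm_gridPt_roundPt_sub_le hh w
  rw [← dist_eq_norm] at h1
  rw [Metric.mem_ball] at hw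
  linarith [dist_triangle (gridPt h (roundPt h w)) w z]

namespace HasRollingDiscs

variable {r R : ℝ}

/-- A shape with inner tangent discs of radius `r` is a union of discs of radius `r`. -/
theorem exists_closedBall_subset (hS : HasRollingDiscs S r R) {P : Plane} (hP : P ∈ S) :
    ∃ x, P ∈ Metric.closedBall x r ∧ Metric.closedBall x r ⊆ S := by
  have hr := hS.r_pos
  by_cases hPr : Metric.closedBall P r ⊆ S
  · exact ⟨P, Metric.mem_closedBall_self hr.le, hPr⟩
  have hne : (frontier S).Nonempty := by
    rw [nonempty_frontier_iff]
    exact ⟨⟨P, hP⟩, hS.isCompact.ne_univ⟩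
  obtain ⟨M, hM, hMd⟩ := (hS.isCompact.of_isClosed_subset isClosed_frontier
    hS.isClosed.frontier_subset).exists_infDist_eq_dist hne P
  set δ := dist P M with hδ
  have hball : Metric.ball P δ ⊆ S := by
    intro Q hQ
    by_contra hQS
    have hPb : P ∈ Metric.ball P δ :=
      Metric.mem_ball_self (dist_nonneg.trans_lt (Metric.mem_ball.1 hQ))
    obtain ⟨z, hz, hzf⟩ := (convex_ball P δ).isPreconnected.exists_mem_frontier hPb hP hQ hQS
    have := Metric.infDist_le_dist_of_mem (x := P) hzf
    rw [Metric.mem_ball, dist_comm] at hz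
    linarith
  have hcball : Metric.closedBall P δ ⊆ S := by
    rcases (dist_nonneg (x := P) (y := M)).eq_or_lt with h0 | h0
    · rw [hδ, ← h0, Metric.closedBall_zero]
      exact singleton_subset_iff.2 hP
    · rw [← closure_ball _ h0.ne']
      exact closure_minimal hball hS.isClosed
  have hδr : δ < r := by
    by_contra hcon
    exact hPr ((Metric.closedBall_subset_closedBall (not_lt.1 hcon)).trans hcball)
  obtain ⟨n, hn⟩ := exists_isNormal hS.convex hS.nonempty_interior hM.2
  refine ⟨M - r • n, ?_, hS.inner_disc M hM n hn⟩
  have h1 := hn.inner_le_of_closedBall dist_nonneg hcball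
  rw [Metric.mem_closedBall, dist_eq_norm]
  refine le_of_sq_le_sq ?_ hr.le
  rw [show P - (M - r • n) = (P - M) + r • n by module, norm_add_sq_real, inner_smul_right,
    norm_smul, hn.1, mul_one, Real.norm_eq_abs, sq_abs, ← dist_eq_norm, ← hδ]
  have h2 : 0 ≤ δ := dist_nonneg
  nlinarith

theorem isCDP (hS : HasRollingDiscs S r R) (hh : 0 < h) (hhr : 16 * h ≤ r) :
    IsCDP h (gaussDig h S) := by
  have h2 : 2 * h ≤ r := by linarith
  obtain ⟨c, D, -, hc, -⟩ := hS.exists_disc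
  refine ⟨finite_gaussDig hh hS.isCompact.isBounded, ?_, ?_, ?_⟩
  · exact convexHull_nonempty_iff.1
      ⟨c, mem_convexHull_gaussDig hh ((Metric.closedBall_subset_closedBall h2).trans hc)⟩
  · rintro _ ⟨hP, k, rfl⟩ _ ⟨hQ, l, rfl⟩
    obtain ⟨x, hxP, hx⟩ := hS.exists_closedBall_subset hP
    obtain ⟨y, hyQ, hy⟩ := hS.exists_closedBall_subset hQ
    have h3 := fourConnected_roundPt hh hx k hxP
    have h4 := fourConnected_roundPt hh hy l hyQ
    have h5 := fourConnected_roundPt_roundPt hh hS.convex h2 hx hy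
    exact (h3.trans h5).trans h4.symm
  · apply Subset.antisymm
    · exact fun P hP => ⟨subset_convexHull ℝ _ hP, hP.2⟩
    · exact inter_subset_inter_left _ (convexHull_gaussDig_subset hS.convex h)

theorem nonempty_interior_convexHull (hS : HasRollingDiscs S r R) (hh : 0 < h)
    (hhr : 16 * h ≤ r) : (interior (convexHull ℝ (gaussDig h S))).Nonempty := by
  obtain ⟨c, D, -, hc, -⟩ := hS.exists_disc
  refine ⟨c, mem_interior.2 ⟨Metric.ball c (r - 2 * h), ?_, Metric.isOpen_ball,
    Metric.mem_ball_self (by linarith)⟩⟩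
  exact Metric.ball_subset_closedBall.trans (closedBall_subset_convexHull_gaussDig hh hc)

end HasRollingDiscs

end

noncomputable section

/-! ### Multigrid convergence -/

/-- The rate `τ h = h ^ (1 / 4)` suits all shapes: the error is at most a constant that depends on
the shape times the square root of `h`. -/
theorem exists_multigrid_bound {S : Set Plane} (hC : S ∈ ConvexC3Shapes) :
    ∃ hS : ℝ, 0 < hS ∧ ∀ h, 0 < h → h < hS →
      IsCDP h (gaussDig h S) ∧
      ∀ M v d, IsTangent S M v → IsDown v d →
        (∃ e ∈ edges h (gaussDig h S), LiesBelow h (gaussDig h S) e M d) ∧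
        ∀ e ∈ edges h (gaussDig h S), LiesBelow h (gaussDig h S) e M d →
          directionError h e v ≤ √(√h) := by
  obtain ⟨r, R, hS⟩ := exists_hasRollingDiscs hC
  have hr := hS.r_pos
  have hR := hS.R_pos
  obtain ⟨h₀, hh₀, herr⟩ := hS.exists_directionError_le hC
  set C : ℝ := (15 / r) ^ 2 * (24 * R) with hCdef
  have hCpos : 0 < C := by positivity
  refine ⟨min h₀ (min (r / 16) (1 / C ^ 2)), by positivity, fun h hh hlt => ?_⟩
  have h1 : h < h₀ := hlt.trans_le (min_le_left _ _)
  have h2 : 16 * h ≤ r := by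
    have := hlt.trans_le ((min_le_right _ _).trans (min_le_left _ _))
    linarith
  have h3 : h * C ^ 2 < 1 := by
    have := hlt.trans_le ((min_le_right _ _).trans (min_le_right _ _))
    rwa [lt_div_iff₀ (by positivity)] at this
  refine ⟨hS.isCDP hh h2, fun M v d hv hd => ⟨?_, fun e he hb => ?_⟩⟩
  · obtain ⟨hv0, hM, hn⟩ := hv.isNormal hC
    exact exists_liesBelow hS.isCompact hS.convex hh (hS.nonempty_interior_convexHull hh h2) hM
      (by positivity) (hS.add_smul_down_mem hh h2 hv0 hM hn hd)
  · refine (herr h hh h1 e he M v d hv hd hb).trans (Real.le_sqrt_of_sq_le ?_)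
    refine le_trans ?_ (Real.le_sqrt_of_sq_le (x := C * h) ?_)
    · rw [mul_pow, hCdef, mul_assoc]
      exact mul_le_mul_of_nonneg_left (hS.norm_edgeVec_sq_le hh he) (by positivity)
    · nlinarith

theorem mainTheorem2 (M : Plane) :
    (∃ τ : ℝ → ℝ, (∀ h, 0 < h → 0 < τ h) ∧ Tendsto τ (𝓝[>] 0) (𝓝 0) ∧
      ∀ S ∈ ConvexC3ShapesThrough M, ∃ hS : ℝ, 0 < hS ∧ ∀ h, 0 < h → h < hS →
        IsCDP h (gaussDig h S) ∧
        ∀ v d, IsTangent S M v → IsDown v d →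
          (∃ e ∈ edges h (gaussDig h S), LiesBelow h (gaussDig h S) e M d) ∧
          ∀ e ∈ edges h (gaussDig h S), LiesBelow h (gaussDig h S) e M d →
            directionError h e v ≤ τ h) ∧
    ∀ S ∈ ConvexC3ShapesThrough M, AsymptoticEdgeLaw S →
      (fun h : ℝ => edgeMean h S (worstError h S)) =O[𝓝[>] 0] (fun h : ℝ => h ^ (2 / 3 : ℝ)) := by
  refine ⟨⟨fun h => √(√h), fun h hh => by positivity, ?_, fun S hS => ?_⟩,
    fun S hS hlaw => isBigO_edgeMean_worstError hS.1 hlaw⟩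
  · have hcont : Continuous fun h : ℝ => √(√h) := by fun_prop
    simpa using (hcont.tendsto 0).mono_left nhdsWithin_le_nhds
  · obtain ⟨h₀, hh₀, hbound⟩ := exists_multigrid_bound hS.1
    exact ⟨h₀, hh₀, fun h hh hlt => ⟨(hbound h hh hlt).1, (hbound h hh hlt).2 M⟩⟩

end
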